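/- Let $d\in\mathbb{N}$, $N\ge 1$, and let $F_1,\dots,F_N:\mathbb{R}^d\to\mathbb{R}^d$. On a probability space $(\Omega,\mathcal{F},P)$ let $X_0$ be an $\mathbb{R}^d$-valued random variable, $(\xi_n)_{n\in\mathbb{N}}$ an i.i.d. sequence of $d$-dimensional standard Gaussian random variables, and $(S_n)_{n\in\mathbb{N}}$ an i.i.d. sequence of uniform draws from $\{1,\dots,N\}$, such that $X_0$, $(\xi_n)_{n\in\mathbb{N}}$ and $(S_n)_{n\in\mathbb{N}}$ are independent. For a step size $\eta>0$, the SAGA-LD chain $(X_n,G_n)$, with $X_n\in\mathbb{R}^d$ and $G_n=(G_n^1,\dots,G_n^N)\in\mathbb{R}^{Nd}$, is defined by $G_0^i=F_i(X_0)$ and, for $n\ge 0$, $$G^{i}_{n+1}=1_{\{S_{n}\neq i\}}G^{i}_{n}+1_{\{S_{n}=i\}}F_{i}(X_{n}),\quad i=1,\dots,N,$$ $$X_{n+1}=X_{n}-\frac{\eta}{N}\sum_{i=1}^{N}G^{i}_{n}-\eta\bigl(F_{S_{n}}(X_{n})-G^{S_{n}}_{n}\bigr)+\sqrt{2\eta}\,\xi_{n+1}.$$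 Assume that $E[|X_0|^2]<\infty$; that there are $c_1,c_2>0$ with $$\Bigl\langle \frac1N\sum_{i=1}^N F_i(x),x\Bigr\rangle\ge c_2|x|^2-c_1\quad\text{for all }x\in\mathbb{R}^d;$$ and that there is $M>0$ with $|F_i(x)-F_i(y)|\le M|x-y|$ for all $i$ and all $x,y\in\mathbb{R}^d$. (Here $|\cdot|$ is the Euclidean norm.) Then there is $\eta_0>0$ such that for every $0<\eta\le\eta_0$ there exists a probability $\mu_*=\mu_*(\eta)$ on $\mathbb{R}^d\times\mathbb{R}^{Nd}$ such that $$d_{TV}(\mathrm{Law}(X_n,G_n),\mu_*)\to 0,\qquad n\to\infty,$$ where $d_{TV}(\mu_1,\mu_2)=\inf P(Y_1\ne Y_2)$, the infimum being taken over all pairs of random variables $Y_1,Y_2$ (defined on a common probability space) with laws $\mu_1,\mu_2$. Moreover, for every measurable $\phi:\mathbb{R}^{(N+1)d}\to\mathbb{R}$ for which there is $C>0$ with $|\phi(u)|\le C(1+|u|)$ for all $u$, the function $\phi$ is $\mu_*$-integrable, each $\phi(X_n,G_n)$ is integrable, and $$E\left[\left|\frac{\phi(X_1,G_1)+\dots+\phi(X_n,G_n)}{n}-\int_{\mathbb{R}^{(N+1)d}}\phi\,d\mu_*\right|\right]\to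 0,\qquad n\to\infty;$$ in particular, the averages converge to $\int\phi\,d\mu_*$ in probability. -/

import Mathlib

open MeasureTheory ProbabilityTheory Filter Topology
open scoped ENNReal InnerProductSpace

namespace SagaLD

/-- The total variation distance of two laws on `E`: the infimum of `P(X₁ ≠ X₂)` over all pairs
`(X₁, X₂)` of random variables with `X₁ ∼ μ₁`, `X₂ ∼ μ₂`. Since `P(X₁ ≠ X₂)` depends only on the
joint law, the infimum is written over the joint laws `π` on `E × E`. -/
noncomputable def dTV {E : Type*} [MeasurableSpace E] (μ₁ μ₂ : Measure E) : ℝ≥0∞ :=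
  ⨅ (π : Measure (E × E)) (_ : π.map Prod.fst = μ₁ ∧ π.map Prod.snd = μ₂),
    π {p : E × E | p.1 ≠ p.2}

/-- The state space `ℝ^d × ℝ^{Nd}` of the chain, the second factor being made of `N` blocks. -/
abbrev State (d N : ℕ) : Type :=
  EuclideanSpace ℝ (Fin d) × (Fin N → EuclideanSpace ℝ (Fin d))

/-- The Euclidean norm on `ℝ^d × ℝ^{Nd} = ℝ^{(N+1)d}`. (The norm that Mathlib puts on a product
is the maximum norm.) -/
noncomputable def euclNorm {d N : ℕ} (u : State d N) : ℝ :=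
  √(‖u.1‖ ^ 2 + ∑ i, ‖u.2 i‖ ^ 2)

/-- One step of SAGA-LD from the state `u = (x, g)`, with drawn index `s` and noise `z`. -/
noncomputable def step {d N : ℕ}
    (F : Fin N → EuclideanSpace ℝ (Fin d) → EuclideanSpace ℝ (Fin d)) (η : ℝ)
    (u : State d N) (s : Fin N) (z : EuclideanSpace ℝ (Fin d)) : State d N :=
  (u.1 - (η / N) • ∑ i, u.2 i - η • (F s u.1 - u.2 s) + √(2 * η) • z,
    fun i => if s = i then F i u.1 else u.2 i)

/-- The SAGA-LD chain `(X_n, G_n)` with step size `η`, started from `X₀` and `G₀ⁱ = F_i(X₀)`: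
the step from time `n` to time `n + 1` uses the index `S_n` and the noise `ξ_{n+1}`. -/
noncomputable def chain {d N : ℕ} {Ω : Type*}
    (F : Fin N → EuclideanSpace ℝ (Fin d) → EuclideanSpace ℝ (Fin d)) (η : ℝ)
    (X₀ : Ω → EuclideanSpace ℝ (Fin d)) (S : ℕ → Ω → Fin N)
    (ξ : ℕ → Ω → EuclideanSpace ℝ (Fin d)) : ℕ → Ω → State d N
  | 0, ω => (X₀ ω, fun i => F i (X₀ ω))
  | n + 1, ω => step F η (chain F η X₀ S ξ n ω) (S n ω) (ξ (n + 1) ω)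

/-- The ergodic average `(φ(X_1, G_1) + ⋯ + φ(X_n, G_n)) / n`. -/
noncomputable def ergodicAverage {d N : ℕ} {Ω : Type*} (φ : State d N → ℝ)
    (Z : ℕ → Ω → State d N) (n : ℕ) (ω : Ω) : ℝ :=
  (∑ j ∈ Finset.Icc 1 n, φ (Z j ω)) / n

end SagaLD

/-! Memory and position together form a Markov chain `(X_n, G_n)`, driven by independent noise
`(S_n, ξ_{n+1})`. Two properties of its kernel carry the theorem.

Drift. For `V(x, g) = |x|² + κ ∑ |gⁱ|²` the gradient estimate is unbiased, so dissipativity of the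
mean gradient contracts `|x|²`. The refreshment of one uniformly drawn gradient contracts `∑ |gⁱ|²`
by `1 - 1/N`, up to a term in `|x|²`. With `κ` proportional to `η` and `η` small, the cross terms
are absorbed (`exists_lyapunov_drift`). This alone restricts the step size.

Minorization. The noise acts on the position only, so a single step is degenerate. With positive
probability, however, `N + 1` steps draw one index and then every index once. Each Gaussian move
dominates a multiple of the uniform measure on a cube: the first draw erases the initial position,
and the next `N` steps replace all stored gradients by values at positions drawn from the cube. The
resulting minorant does not depend on the initial state, as long as this stays in a bounded set
(`exists_minorizing_measure`).

The argument of Hairer and Mattingly turns both into contraction of oscillations weighted by `1 +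
βW` (`harris`). Hence the laws are uniformly Cauchy on measurable sets; their limit is invariant,
and a maximal coupling yields the total variation statement. The weight is `W = √V`: it grows
linearly, so it dominates every admissible `φ`, and `W² = V` has bounded expectation along the
chain. Therefore the correlations of the centred `φ(X_n, G_n)` decay with the lag, uniformly in time
and without stationarity, and a second moment computation proves the law of large numbers in `L¹`.
-/

namespace SagaLD

/-! ### Harris' theorem: contraction of weighted oscillations -/

section Harris

variable {E : Type*}

/-- The intervals `[φ x - w x, φ x + w x]` meet pairwise, so on the line they have a common point;
the supremum of the left endpoints is one. -/
lemma exists_center {φ w : E → ℝ} (h : ∀ x y, |φ x - φ y| ≤ w x + w y) :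
    ∃ c, ∀ x, |φ x - c| ≤ w x := by
  rcases isEmpty_or_nonempty E with hE | ⟨⟨x₀⟩⟩
  · exact ⟨0, fun x => hE.elim x⟩
  have key : ∀ x y, φ x - w x ≤ φ y + w y := fun x y => by
    have := (abs_le.1 (h x y)).2; linarith
  have bdd : BddAbove (Set.range fun x => φ x - w x) :=
    ⟨φ x₀ + w x₀, by rintro _ ⟨x, rfl⟩; exact key x x₀⟩
  have : Nonempty E := ⟨x₀⟩
  refine ⟨⨆ x, φ x - w x, fun x => abs_le.2 ⟨?_, ?_⟩⟩
  · have : (⨆ x, φ x - w x) ≤ φ x + w x := ciSup_le fun y => key y x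
    linarith
  · have := le_ciSup bdd x
    linarith

variable [MeasurableSpace E]

lemma integrable_of_oscillation {φ w : E → ℝ} (hφ : Measurable φ)
    (h : ∀ x y, |φ x - φ y| ≤ w x + w y) {p : Measure E} [IsFiniteMeasure p]
    (hw : Integrable w p) : Integrable φ p := by
  obtain ⟨c, hc⟩ := exists_center h
  have : Integrable (fun x => φ x - c) p :=
    hw.mono' (hφ.sub_const c).aestronglyMeasurable (Eventually.of_forall hc)
  exact (this.add (integrable_const c)).congr (Eventually.of_forall fun x => by simp)

/-- Two finite measures of equal mass, tested on a function whose oscillation is controlled by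
the weight `w`. -/
lemma abs_integral_sub_integral_le {φ w : E → ℝ} (hφ : Measurable φ)
    (h : ∀ x y, |φ x - φ y| ≤ w x + w y) {p q : Measure E} [IsFiniteMeasure p]
    [IsFiniteMeasure q] (hpq : p.real Set.univ = q.real Set.univ)
    (hp : Integrable w p) (hq : Integrable w q) :
    |∫ x, φ x ∂p - ∫ x, φ x ∂q| ≤ ∫ x, w x ∂p + ∫ x, w x ∂q := by
  obtain ⟨c, hc⟩ := exists_center h
  have ip := integrable_of_oscillation hφ h hp
  have iq := integrable_of_oscillation hφ h hq
  have e : ∫ x, φ x ∂p - ∫ x, φ x ∂q = ∫ x, (φ x - c) ∂p - ∫ x, (φ x - c) ∂q := by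
    rw [integral_sub ip (integrable_const c), integral_sub iq (integrable_const c)]
    simp [hpq]
  have bound : ∀ {r : Measure E}, IsFiniteMeasure r → Integrable w r →
      |∫ x, (φ x - c) ∂r| ≤ ∫ x, w x ∂r := fun {r} _ hr =>
    (Real.norm_eq_abs _).symm.le.trans
      (norm_integral_le_of_norm_le hr (Eventually.of_forall fun x => hc x))
  rw [e]
  exact (abs_sub _ _).trans (add_le_add (bound inferInstance hp) (bound inferInstance hq))

/-- One step of Harris' theorem in the formulation of Hairer and Mattingly: a drift condition and
a minorization on a large sublevel set give a contraction of weighted oscillations. -/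
theorem harris_contraction {P : Kernel E E} [IsMarkovKernel P] {W : E → ℝ} (hW0 : ∀ x, 0 ≤ W x)
    (hWi : ∀ x, Integrable W (P x)) {lam b : ℝ} (hlam0 : 0 ≤ lam) (hlam1 : lam < 1)
    (hb : 0 ≤ b) (hdrift : ∀ x, ∫ y, W y ∂P x ≤ lam * W x + b)
    (hmin : ∀ R : ℝ, ∃ ν : Measure E, IsFiniteMeasure ν ∧ ν ≠ 0 ∧ ∀ x, W x ≤ R → ν ≤ P x) :
    ∃ β : ℝ, 0 < β ∧ ∃ γ : ℝ, 0 ≤ γ ∧ γ < 1 ∧ ∀ φ : E → ℝ, Measurable φ → ∀ A : ℝ,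
      (∀ x y, |φ x - φ y| ≤ A * ((1 + β * W x) + (1 + β * W y))) →
      ∀ x y, |∫ z, φ z ∂P x - ∫ z, φ z ∂P y| ≤ γ * A * ((1 + β * W x) + (1 + β * W y)) := by
  -- Above level `R` the two additive constants `b` are absorbed into the factor `lam' = lam + 2b/R
  -- < 1`.
  set R : ℝ := 2 * b / (1 - lam) + 1 with hR
  have h1l : 0 < 1 - lam := by linarith
  have hRpos : 0 < R := by positivity
  have hbR : 2 * b < (1 - lam) * R := by
    rw [hR, mul_add, mul_div_cancel₀ _ h1l.ne']; linarith
  obtain ⟨ν, hνf, hν0, hν⟩ := hmin R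
  set ε : ℝ := ν.real Set.univ with hε
  have hεpos : 0 < ε := by
    exact ENNReal.toReal_pos (Measure.measure_univ_pos.2 hν0).ne' (measure_ne_top _ _)
  -- Removing the common mass gains `2ε`; with this `β` the drift constants cost at most `ε` of it.
  obtain ⟨β, hβ⟩ : ∃ β : ℝ, β = ε / (2 * (b + 1)) := ⟨_, rfl⟩
  have hβpos : 0 < β := by rw [hβ]; positivity
  have hβb : 2 * β * b ≤ ε := by
    rw [hβ]
    have : 2 * (ε / (2 * (b + 1))) * b = ε * (b / (b + 1)) := by field_simp
    rw [this]
    exact mul_le_of_le_one_right hεpos.le ((div_le_one (by linarith)).2 (by linarith))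
  obtain ⟨lam', hlam'⟩ : ∃ l : ℝ, l = lam + 2 * b / R := ⟨_, rfl⟩
  have hl'R : lam' * R = lam * R + 2 * b := by rw [hlam']; field_simp
  have hl'1 : lam' < 1 := by
    by_contra hcon
    have : R ≤ lam' * R := le_mul_of_one_le_left hRpos.le (not_lt.1 hcon)
    nlinarith
  have hl'0 : 0 ≤ lam' := by rw [hlam']; positivity
  -- The ratio `(2 + β lam' S) / (2 + β S)` decreases in `S`, so its value at `S = R` serves for all
  -- `S ≥ R`.
  obtain ⟨γ₁, hγ₁⟩ : ∃ g : ℝ, g = (2 + β * lam' * R) / (2 + β * R) := ⟨_, rfl⟩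
  have hβR : 0 < 2 + β * R := by positivity
  refine ⟨β, hβpos, max γ₁ (max (1 - ε / 2) lam), le_max_of_le_right (le_max_of_le_right hlam0),
    max_lt ?_ (max_lt (by linarith) hlam1), ?_⟩
  · rw [hγ₁, div_lt_one hβR]
    have : β * R * lam' < β * R * 1 := by gcongr
    linarith
  intro φ hφ A hosc x y
  set γ := max γ₁ (max (1 - ε / 2) lam)
  have hA : 0 ≤ A := by
    by_contra hcon
    have h := hosc x x
    have := mul_neg_of_neg_of_pos (not_le.1 hcon)
      (show 0 < (1 + β * W x) + (1 + β * W x) by have := hW0 x; positivity)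
    simp only [sub_self, abs_zero] at h
    linarith
  have hosc' : ∀ x y, |φ x - φ y| ≤ (A * (1 + β * W x)) + (A * (1 + β * W y)) := fun x y => by
    rw [← mul_add]; exact hosc x y
  have iw : ∀ x, Integrable (fun z => A * (1 + β * W z)) (P x) := fun x =>
    ((integrable_const 1).add ((hWi x).const_mul β)).const_mul A
  have vw : ∀ (r : Measure E) [IsFiniteMeasure r], Integrable W r →
      ∫ z, A * (1 + β * W z) ∂r = A * (r.real Set.univ + β * ∫ z, W z ∂r) := fun r _ hr => by
    rw [integral_const_mul, integral_add (integrable_const 1) (hr.const_mul β),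
      integral_const_mul]
    simp
  set S := W x + W y with hS
  have hS0 : 0 ≤ S := add_nonneg (hW0 x) (hW0 y)
  have tgt : (1 + β * W x) + (1 + β * W y) = 2 + β * S := by rw [hS]; ring
  have hPW : ∫ z, W z ∂P x + ∫ z, W z ∂P y ≤ lam * S + 2 * b := by
    have := hdrift x; have := hdrift y; rw [hS]; linarith
  rw [tgt, mul_right_comm, mul_comm]
  -- Far out, the drift alone contracts. Otherwise both points lie in the sublevel set: the common
  -- part `ν` cancels in the difference and only mass `1 - ε` remains on each side.
  by_cases hRS : R ≤ S
  · have h1 := abs_integral_sub_integral_le hφ hosc' (p := P x) (q := P y) (by simp) (iw x) (iw y)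
    rw [vw _ (hWi x), vw _ (hWi y)] at h1
    refine h1.trans ?_
    rw [← mul_add]
    refine mul_le_mul_of_nonneg_left ?_ hA
    have h2 : lam * S + 2 * b ≤ lam' * S := by
      have : 2 * b = 2 * b / R * R := by field_simp
      have : 2 * b / R * R ≤ 2 * b / R * S := by gcongr
      rw [hlam', add_mul]; linarith
    have h3 : 2 + β * (lam' * S) ≤ γ₁ * (2 + β * S) := by
      rw [hγ₁, div_mul_eq_mul_div, le_div_iff₀ hβR]
      have : 0 ≤ 2 * β * (1 - lam') * (S - R) :=
        mul_nonneg (mul_nonneg (by positivity) (by linarith)) (by linarith)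
      nlinarith
    have h4 : γ₁ * (2 + β * S) ≤ γ * (2 + β * S) := by
      gcongr; exact le_max_left _ _
    have h5 : β * (∫ z, W z ∂P x + ∫ z, W z ∂P y) ≤ β * (lam' * S) := by
      gcongr; linarith
    simp only [probReal_univ]
    linarith
  · have hx : ν ≤ P x := hν x (by have := hW0 y; linarith)
    have hy : ν ≤ P y := hν y (by have := hW0 x; linarith)
    have dec : ∀ x, ν ≤ P x → (∫ z, φ z ∂P x = ∫ z, φ z ∂(P x - ν) + ∫ z, φ z ∂ν)
        ∧ (P x - ν).real Set.univ = 1 - ε ∧ ∫ z, W z ∂(P x - ν) ≤ ∫ z, W z ∂P x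
        ∧ Integrable W (P x - ν) := by
      intro x hx
      have hcancel := Measure.sub_add_cancel_of_le hx
      have hle : P x - ν ≤ P x := Measure.sub_le
      have iφ := integrable_of_oscillation hφ hosc' (iw x)
      refine ⟨?_, ?_, integral_mono_measure hle (Eventually.of_forall hW0) (hWi x),
        (hWi x).mono_measure hle⟩
      · conv_lhs => rw [← hcancel]
        exact integral_add_measure (iφ.mono_measure hle) (iφ.mono_measure hx)
      · have : (P x).real Set.univ = (P x - ν).real Set.univ + ν.real Set.univ := by
          conv_lhs => rw [← hcancel]
          exact measureReal_add_apply
        rw [probReal_univ] at this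
        linarith
    obtain ⟨ex, mx, wx, ix⟩ := dec x hx
    obtain ⟨ey, my, wy, iy⟩ := dec y hy
    rw [ex, ey, add_sub_add_right_eq_sub]
    have iw' : ∀ r : Measure E, IsFiniteMeasure r → Integrable W r →
        Integrable (fun z => A * (1 + β * W z)) r := fun r _ hr =>
      ((integrable_const 1).add (hr.const_mul β)).const_mul A
    have h1 := abs_integral_sub_integral_le hφ hosc' (p := P x - ν) (q := P y - ν)
      (by rw [mx, my]) (iw' _ inferInstance ix) (iw' _ inferInstance iy)
    rw [vw _ ix, vw _ iy, mx, my] at h1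
    refine h1.trans ?_
    rw [← mul_add]
    refine mul_le_mul_of_nonneg_left ?_ hA
    have h5 : β * (∫ z, W z ∂(P x - ν) + ∫ z, W z ∂(P y - ν)) ≤ β * (lam * S + 2 * b) :=
      mul_le_mul_of_nonneg_left (by linarith) hβpos.le
    have g1 : (1 - ε / 2) * 2 ≤ γ * 2 := by
      gcongr; exact (le_max_left _ _).trans (le_max_right _ _)
    have g2 : lam * (β * S) ≤ γ * (β * S) := by
      gcongr; exact (le_max_right _ _).trans (le_max_right _ _)
    nlinarith

/-- The drift condition along the powers of a kernel. -/
lemma drift_pow {K : Kernel E E} [IsMarkovKernel K] {W : E → ℝ} (hW0 : ∀ x, 0 ≤ W x)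
    (hWm : Measurable W)
    (hWi : ∀ x, Integrable W (K x)) {lam b : ℝ} (hlam0 : 0 ≤ lam) (hlam1 : lam < 1)
    (hdrift : ∀ x, ∫ y, W y ∂K x ≤ lam * W x + b) (n : ℕ) :
    ∀ x, Integrable W ((K ^ n) x) ∧
      ∫ y, W y ∂(K ^ n) x ≤ lam ^ n * W x + b / (1 - lam) * (1 - lam ^ n) := by
  induction n with
  | zero =>
    intro x
    have : (K ^ 0) x = Measure.dirac x := by
      rw [pow_zero]; exact Kernel.id_apply x
    rw [this]
    have hi : Integrable W (Measure.dirac x) :=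
      integrable_dirac' hWm.stronglyMeasurable (by simp)
    exact ⟨hi, by simp [integral_dirac' _ _ hWm.stronglyMeasurable]⟩
  | succ n ih =>
    intro x
    have hK : (K ^ (n + 1)) x = ((K ^ n) ∘ₖ K) x := by rw [pow_succ]; rfl
    set B := b / (1 - lam)
    have hB : b = B * (1 - lam) := by
      rw [div_mul_cancel₀]; linarith
    have hdom : Integrable (fun y => lam ^ n * W y + B * (1 - lam ^ n)) (K x) :=
      ((hWi x).const_mul _).add (integrable_const _)
    have hmeas : StronglyMeasurable fun y => ∫ z, W z ∂(K ^ n) y :=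
      hWm.stronglyMeasurable.integral_kernel
    have hi2 : Integrable (fun y => ∫ z, W z ∂(K ^ n) y) (K x) := by
      refine hdom.mono' hmeas.aestronglyMeasurable (Eventually.of_forall fun y => ?_)
      rw [Real.norm_of_nonneg (integral_nonneg hW0)]
      exact (ih y).2
    have hi : Integrable W ((K ^ (n + 1)) x) := by
      rw [hK, integrable_comp_iff hWm.aestronglyMeasurable]
      refine ⟨Eventually.of_forall fun y => (ih y).1, ?_⟩
      refine hi2.congr (Eventually.of_forall fun y => ?_)
      exact integral_congr_ae (Eventually.of_forall fun z => (Real.norm_of_nonneg (hW0 z)).symm)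
    refine ⟨hi, ?_⟩
    rw [hK] at hi ⊢
    rw [Kernel.integral_comp hi]
    calc ∫ y, ∫ z, W z ∂(K ^ n) y ∂K x
        ≤ ∫ y, (lam ^ n * W y + B * (1 - lam ^ n)) ∂K x :=
          integral_mono hi2 hdom fun y => (ih y).2
      _ = lam ^ n * ∫ y, W y ∂K x + B * (1 - lam ^ n) := by
          rw [integral_add ((hWi x).const_mul _) (integrable_const _), integral_const_mul]
          simp
      _ ≤ lam ^ n * (lam * W x + b) + B * (1 - lam ^ n) := by
          gcongr; exact hdrift x
      _ = _ := by rw [hB]; ring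

instance isMarkovKernel_pow (K : Kernel E E) [IsMarkovKernel K] (n : ℕ) :
    IsMarkovKernel (K ^ n) := by
  induction n with
  | zero => rw [pow_zero]; exact inferInstanceAs (IsMarkovKernel Kernel.id)
  | succ n ih => rw [pow_succ]; exact inferInstanceAs (IsMarkovKernel ((K ^ n) ∘ₖ K))

lemma integral_pow_add {K : Kernel E E} (m n : ℕ) {φ : E → ℝ} {x : E}
    (h : Integrable φ ((K ^ (m + n)) x)) :
    ∫ z, φ z ∂(K ^ (m + n)) x = ∫ y, ∫ z, φ z ∂(K ^ m) y ∂(K ^ n) x := by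
  rw [Kernel.pow_add] at h ⊢
  exact Kernel.integral_comp h

/-- **Harris' theorem** on the contraction of weighted oscillations along the powers of a
kernel, some power of which is minorized on sublevel sets. -/
theorem harris {K : Kernel E E} [IsMarkovKernel K] {W : E → ℝ} (hW0 : ∀ x, 0 ≤ W x)
    (hWm : Measurable W) (hWi : ∀ x, Integrable W (K x)) {lam b : ℝ} (hlam0 : 0 ≤ lam)
    (hlam1 : lam < 1) (hb : 0 ≤ b) (hdrift : ∀ x, ∫ y, W y ∂K x ≤ lam * W x + b)
    {m : ℕ} (hm : m ≠ 0)
    (hmin : ∀ R : ℝ, ∃ ν : Measure E, IsFiniteMeasure ν ∧ ν ≠ 0 ∧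
      ∀ x, W x ≤ R → ν ≤ (K ^ m) x) :
    ∃ β : ℝ, 0 < β ∧ ∃ a : ℕ → ℝ, (∀ n, 0 ≤ a n) ∧ Tendsto a atTop (𝓝 0) ∧
      ∀ φ : E → ℝ, Measurable φ → ∀ A : ℝ,
      (∀ x y, |φ x - φ y| ≤ A * ((1 + β * W x) + (1 + β * W y))) → ∀ n x y,
      |∫ z, φ z ∂(K ^ n) x - ∫ z, φ z ∂(K ^ n) y| ≤
        a n * A * ((1 + β * W x) + (1 + β * W y)) := by
  have hdp := drift_pow hW0 hWm hWi hlam0 hlam1 hdrift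
  have h1l : 0 < 1 - lam := by linarith
  set b' := b / (1 - lam) with hb'
  have hb'0 : 0 ≤ b' := by positivity
  have hpow0 : ∀ n, 0 ≤ lam ^ n := fun n => pow_nonneg hlam0 n
  -- As `m ≠ 0`, `lam ^ m ≤ lam`, so the one-step contraction applies to `K ^ m` with the same
  -- factor.
  have hd1 : ∀ x, ∫ y, W y ∂(K ^ m) x ≤ lam * W x + b' := fun x => by
    refine (hdp m x).2.trans ?_
    have h1 : lam ^ m * W x ≤ lam * W x :=
      mul_le_mul_of_nonneg_right (pow_le_of_le_one hlam0 hlam1.le hm) (hW0 x)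
    have := mul_nonneg hb'0 (hpow0 m)
    linarith
  have hd2 : ∀ n x, ∫ y, W y ∂(K ^ n) x ≤ W x + b' := fun n x => by
    refine (hdp n x).2.trans ?_
    have h1 : lam ^ n * W x ≤ W x :=
      mul_le_of_le_one_left (hW0 x) (pow_le_one₀ hlam0 hlam1.le)
    have := mul_nonneg hb'0 (hpow0 n)
    linarith
  obtain ⟨β, hβ, γ, hγ0, hγ1, H⟩ :=
    harris_contraction hW0 (fun x => (hdp m x).1) hlam0 hlam1 hb'0 hd1 hmin
  have iw : ∀ A n x, Integrable (fun z => A * (1 + β * W z)) ((K ^ n) x) := fun A n x =>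
    ((integrable_const 1).add ((hdp n x).1.const_mul β)).const_mul A
  have iφ : ∀ (φ : E → ℝ), Measurable φ → ∀ A : ℝ,
      (∀ x y, |φ x - φ y| ≤ A * ((1 + β * W x) + (1 + β * W y))) → ∀ n x,
      Integrable φ ((K ^ n) x) := fun φ hφ A hosc n x =>
    integrable_of_oscillation hφ (fun x y => (hosc x y).trans_eq (mul_add _ _ _)) (iw A n x)
  have meas : ∀ (φ : E → ℝ), Measurable φ → ∀ n, Measurable fun x => ∫ z, φ z ∂(K ^ n) x :=
    fun φ hφ n => (hφ.stronglyMeasurable.integral_kernel (κ := K ^ n)).measurable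
  have iter : ∀ q : ℕ, ∀ φ : E → ℝ, Measurable φ → ∀ A : ℝ,
      (∀ x y, |φ x - φ y| ≤ A * ((1 + β * W x) + (1 + β * W y))) → ∀ x y,
      |∫ z, φ z ∂(K ^ (m * q)) x - ∫ z, φ z ∂(K ^ (m * q)) y| ≤
        γ ^ q * A * ((1 + β * W x) + (1 + β * W y)) := by
    intro q
    induction q with
    | zero =>
      intro φ hφ A hosc x y
      have : ∀ x, (K ^ (m * 0)) x = Measure.dirac x := fun x => by
        rw [mul_zero, pow_zero]; exact Kernel.id_apply x
      rw [this, this, integral_dirac' _ _ hφ.stronglyMeasurable,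
        integral_dirac' _ _ hφ.stronglyMeasurable, pow_zero, one_mul]
      exact hosc x y
    | succ q ih =>
      intro φ hφ A hosc x y
      rw [mul_add, mul_one, add_comm, integral_pow_add _ _ (iφ φ hφ A hosc _ x),
        integral_pow_add _ _ (iφ φ hφ A hosc _ y)]
      refine (ih _ (meas φ hφ m) (γ * A) (H φ hφ A hosc) x y).trans_eq ?_
      ring
  -- Full blocks of `m` steps contract by `γ` each; the `n % m` remaining steps enlarge the
  -- oscillation by at most `1 + β b'`.
  refine ⟨β, hβ, fun n => γ ^ (n / m) * (1 + β * b'), fun n => by positivity, ?_, ?_⟩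
  · have := (tendsto_pow_atTop_nhds_zero_of_lt_one hγ0 hγ1).comp
      (Nat.tendsto_div_const_atTop hm)
    simpa using this.mul_const (1 + β * b')
  intro φ hφ A hosc n x y
  have hA : 0 ≤ A := by
    by_contra hcon
    have h := hosc x x
    have := mul_neg_of_neg_of_pos (not_le.1 hcon)
      (show 0 < (1 + β * W x) + (1 + β * W x) by have := hW0 x; positivity)
    simp only [sub_self, abs_zero] at h
    linarith
  have hr : ∀ r x y, |∫ z, φ z ∂(K ^ r) x - ∫ z, φ z ∂(K ^ r) y| ≤
      (1 + β * b') * A * ((1 + β * W x) + (1 + β * W y)) := by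
    intro r x y
    have h1 := abs_integral_sub_integral_le hφ
      (fun x y => (hosc x y).trans_eq (mul_add _ _ _)) (p := (K ^ r) x) (q := (K ^ r) y)
      (by simp) (iw A r x) (iw A r y)
    have vw : ∀ x, ∫ z, A * (1 + β * W z) ∂(K ^ r) x ≤ A * (1 + β * (W x + b')) := fun x => by
      rw [integral_const_mul, integral_add (integrable_const 1) ((hdp r x).1.const_mul β),
        integral_const_mul]
      have := mul_le_mul_of_nonneg_left (hd2 r x) hβ.le
      refine mul_le_mul_of_nonneg_left ?_ hA
      simpa using this
    refine h1.trans ((add_le_add (vw x) (vw y)).trans ?_)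
    have : 0 ≤ A * (β * b') * (β * (W x + W y)) := by
      have := hW0 x; have := hW0 y; positivity
    nlinarith
  have hn : n % m + m * (n / m) = n := Nat.mod_add_div n m
  have split : ∀ x, ∫ z, φ z ∂(K ^ n) x
      = ∫ y, ∫ z, φ z ∂(K ^ (n % m)) y ∂(K ^ (m * (n / m))) x := fun x => by
    rw [← integral_pow_add _ _ (iφ φ hφ A hosc _ x), hn]
  rw [split, split]
  refine (iter (n / m) _ (meas φ hφ (n % m)) _ (hr (n % m)) x y).trans_eq ?_
  ring

end Harris

/-! ### Setwise limits of probability measures -/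

section LimitMeasure

variable {E : Type*} [MeasurableSpace E]

lemma hasSum_measureReal_iUnion (μ : Measure E) [IsFiniteMeasure μ] {f : ℕ → Set E}
    (hd : Pairwise (Function.onFun Disjoint f)) (hf : ∀ i, MeasurableSet (f i)) :
    HasSum (fun i => μ.real (f i)) (μ.real (⋃ i, f i)) := by
  have h := measure_iUnion (μ := μ) hd hf
  have := ENNReal.hasSum_toReal (f := fun i => μ (f i)) (h ▸ measure_ne_top _ _)
  rw [← ENNReal.tsum_toReal_eq (fun i => measure_ne_top _ _), ← h] at this
  exact this

/-- Probability measures that are uniformly Cauchy on measurable sets have a limit. -/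
theorem exists_measure_of_uniformly_cauchy {μ : ℕ → Measure E}
    [∀ n, IsProbabilityMeasure (μ n)] {ε : ℕ → ℝ} (hε : Tendsto ε atTop (𝓝 0))
    (h : ∀ A, MeasurableSet A → ∀ n k, |(μ n).real A - (μ (n + k)).real A| ≤ ε n) :
    ∃ ν : Measure E, IsProbabilityMeasure ν ∧
      ∀ A, MeasurableSet A → ∀ n, |(μ n).real A - ν.real A| ≤ ε n := by
  have hlim : ∀ A, ∃ l : ℝ, MeasurableSet A → Tendsto (fun n => (μ n).real A) atTop (𝓝 l) := by
    intro A
    by_cases hA : MeasurableSet A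
    · have : CauchySeq fun n => (μ n).real A := by
        refine cauchySeq_of_le_tendsto_0' ε (fun n m hnm => ?_) hε
        obtain ⟨k, rfl⟩ := Nat.exists_eq_add_of_le hnm
        exact h A hA n k
      obtain ⟨l, hl⟩ := cauchySeq_tendsto_of_complete this
      exact ⟨l, fun _ => hl⟩
    · exact ⟨0, fun h => absurd h hA⟩
  choose L hL using hlim
  have hclose : ∀ A, MeasurableSet A → ∀ n, |(μ n).real A - L A| ≤ ε n := fun A hA n => by
    refine le_of_tendsto ((tendsto_const_nhds.sub
      ((tendsto_add_atTop_iff_nat n).2 (hL A hA))).abs) (Eventually.of_forall fun k => ?_)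
    rw [add_comm k n]
    exact h A hA n k
  have hL0 : ∀ A, MeasurableSet A → 0 ≤ L A := fun A hA =>
    ge_of_tendsto' (hL A hA) fun n => measureReal_nonneg
  have hLempty : L ∅ = 0 :=
    tendsto_nhds_unique (hL ∅ .empty) (by simp)
  have hLuniv : L Set.univ = 1 :=
    tendsto_nhds_unique (hL _ .univ) (by simp)
  have hsum : ∀ f : ℕ → Set E, (∀ i, MeasurableSet (f i)) →
      Pairwise (Function.onFun Disjoint f) → HasSum (fun i => L (f i)) (L (⋃ i, f i)) := by
    intro f hf hd
    have hfin : ∀ n (s : Finset ℕ), (μ n).real (⋃ i ∈ s, f i) = ∑ i ∈ s, (μ n).real (f i) :=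
      fun n s => measureReal_biUnion_finset (fun i _ j _ hij => hd hij) (fun i _ => hf i)
    have hfinL : ∀ s : Finset ℕ, L (⋃ i ∈ s, f i) = ∑ i ∈ s, L (f i) := fun s =>
      tendsto_nhds_unique (hL _ (s.measurableSet_biUnion fun i _ => hf i))
        (by simp_rw [hfin]; exact tendsto_finsetSum _ fun i _ => hL _ (hf i))
    -- Countable additivity passes to the limit because the partial sums are measures of sets, hence
    -- converge uniformly in the finite index set, and the two limits may be exchanged.
    have hunif : TendstoUniformly (fun n (s : Finset ℕ) => ∑ i ∈ s, (μ n).real (f i))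
        (fun s => ∑ i ∈ s, L (f i)) atTop := by
      rw [Metric.tendstoUniformly_iff]
      intro δ hδ
      filter_upwards [hε.eventually (gt_mem_nhds hδ)] with n hn s
      rw [← hfin, ← hfinL, dist_comm, Real.dist_eq]
      exact (hclose _ (s.measurableSet_biUnion fun i _ => hf i) n).trans_lt hn
    exact hunif.tendsto_of_eventually_tendsto
      (Eventually.of_forall fun n => (hasSum_measureReal_iUnion (μ n) hd hf))
      (hL _ (MeasurableSet.iUnion hf))
  let ν : Measure E := Measure.ofMeasurable (fun A _ => ENNReal.ofReal (L A))
    (by simp [hLempty]) (fun f hf hd => by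
      have := hsum f hf hd
      rw [← this.tsum_eq, ENNReal.ofReal_tsum_of_nonneg (fun i => hL0 _ (hf i)) this.summable])
  have hν : ∀ A, MeasurableSet A → ν A = ENNReal.ofReal (L A) := fun A hA =>
    Measure.ofMeasurable_apply A hA
  refine ⟨ν, ⟨by rw [hν _ .univ, hLuniv, ENNReal.ofReal_one]⟩, fun A hA n => ?_⟩
  rw [measureReal_def ν, hν A hA, ENNReal.toReal_ofReal (hL0 A hA)]
  exact hclose A hA n

/-- Fatou's lemma for setwise convergence of measures. -/
theorem lintegral_le_liminf_of_setwise {μ : ℕ → Measure E} {ν : Measure E}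
    (h : ∀ A, MeasurableSet A → Tendsto (fun n => μ n A) atTop (𝓝 (ν A))) (f : E → ℝ≥0∞) :
    ∫⁻ x, f x ∂ν ≤ liminf (fun n => ∫⁻ x, f x ∂μ n) atTop := by
  rw [lintegral_eq_nnreal]
  refine iSup₂_le fun φ hφ => ?_
  have ht : Tendsto (fun n => (φ.map ((↑) : NNReal → ℝ≥0∞)).lintegral (μ n)) atTop
      (𝓝 ((φ.map ((↑) : NNReal → ℝ≥0∞)).lintegral ν)) := by
    simp only [SimpleFunc.map_lintegral]
    exact tendsto_finsetSum _ fun r _ =>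
      ENNReal.Tendsto.const_mul (h _ (φ.measurableSet_preimage _)) (Or.inr ENNReal.coe_ne_top)
  rw [← ht.liminf_eq]
  refine liminf_le_liminf (Eventually.of_forall fun n => ?_)
  rw [← SimpleFunc.lintegral_eq_lintegral]
  exact lintegral_mono fun x => by simpa using hφ x

lemma tendsto_measure_of_abs_sub_le {μ : ℕ → Measure E} [∀ n, IsProbabilityMeasure (μ n)]
    {ν : Measure E} [IsProbabilityMeasure ν] {ε : ℕ → ℝ} (hε : Tendsto ε atTop (𝓝 0))
    {A : Set E} (h : ∀ n, |(μ n).real A - ν.real A| ≤ ε n) :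
    Tendsto (fun n => μ n A) atTop (𝓝 (ν A)) := by
  rw [← ENNReal.tendsto_toReal_iff (fun n => measure_ne_top _ _) (measure_ne_top _ _)]
  exact tendsto_iff_dist_tendsto_zero.2 (squeeze_zero (fun n => dist_nonneg) h hε)

end LimitMeasure

/-! ### Total variation and the maximal coupling -/

section TotalVariation

variable {E : Type*} [MeasurableSpace E]

/-- The maximal coupling bounds the coupling form of the total variation distance by the
largest discrepancy on measurable sets. -/
theorem dTV_le_of_forall_abs_sub_le (hdiag : MeasurableSet {p : E × E | p.1 ≠ p.2})
    {μ ν : Measure E} [IsProbabilityMeasure μ] [IsProbabilityMeasure ν] {ε : ℝ}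
    (h : ∀ A, MeasurableSet A → |μ.real A - ν.real A| ≤ ε) : dTV μ ν ≤ ENNReal.ofReal ε := by
  obtain ⟨s, hs⟩ := exists_isHahnDecomposition μ ν
  -- On `s` one has `μ ≤ ν`, on the complement `ν ≤ μ`. So `κ` is the minimum of the two measures,
  -- and `p`, `q` are the excesses of `μ` and `ν`, which have equal mass `t`.
  set κ := μ.restrict s + ν.restrict sᶜ with hκ
  set p := μ.restrict sᶜ - ν.restrict sᶜ with hp
  set q := ν.restrict s - μ.restrict s with hq
  have hpκ : p + κ = μ := by
    rw [hκ, add_comm (μ.restrict s), ← add_assoc, hp,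
      Measure.sub_add_cancel_of_le hs.ge_on_compl, add_comm,
      Measure.restrict_add_restrict_compl hs.measurableSet]
  have hqκ : q + κ = ν := by
    rw [hκ, ← add_assoc, hq,
      Measure.sub_add_cancel_of_le hs.le_on,
      Measure.restrict_add_restrict_compl hs.measurableSet]
  set t := p Set.univ with ht
  have hpt : t + κ Set.univ = 1 := by
    rw [ht, ← Measure.add_apply, hpκ, measure_univ]
  have hqt : q Set.univ + κ Set.univ = 1 := by
    rw [← Measure.add_apply, hqκ, measure_univ]
  have hqp : q Set.univ = t :=
    WithTop.add_right_cancel (measure_ne_top κ Set.univ) (hqt.trans hpt.symm)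
  have htop : t ≠ ∞ := measure_ne_top _ _
  have htε : t ≤ ENNReal.ofReal ε := by
    rw [ht, hp, Measure.sub_apply .univ hs.ge_on_compl, Measure.restrict_apply_univ,
      Measure.restrict_apply_univ]
    rw [← ENNReal.ofReal_toReal (measure_ne_top μ sᶜ), ← ENNReal.ofReal_toReal
      (measure_ne_top ν sᶜ), ← ENNReal.ofReal_sub _ ENNReal.toReal_nonneg]
    exact ENNReal.ofReal_le_ofReal ((le_abs_self _).trans (h _ hs.measurableSet.compl))
  have hmd : Measurable fun x : E => (x, x) := measurable_id.prodMk measurable_id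
  -- For `t = 0` the factor `t⁻¹` is `∞`, but it then multiplies the zero measure.
  have smul_cancel : ∀ r : Measure E, r Set.univ = t → t⁻¹ • t • r = r := fun r hr => by
    rcases eq_or_ne t 0 with h0 | h0
    · rw [h0, Measure.measure_univ_eq_zero] at hr
      simp [hr]
    · rw [smul_smul, ENNReal.inv_mul_cancel h0 htop, one_smul]
  -- The common part sits on the diagonal and the excesses are coupled independently, so at most
  -- mass `t` lies off the diagonal.
  refine (iInf₂_le (κ.map (fun x => (x, x)) + t⁻¹ • p.prod q) ?_).trans ?_
  · constructor
    · rw [Measure.map_add _ _ measurable_fst, Measure.map_smul, Measure.map_fst_prod,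
        Measure.map_map measurable_fst hmd, hqp, smul_cancel p rfl]
      change κ.map id + p = μ
      rw [Measure.map_id, add_comm, hpκ]
    · rw [Measure.map_add _ _ measurable_snd, Measure.map_smul, Measure.map_snd_prod,
        Measure.map_map measurable_snd hmd, smul_cancel q hqp]
      change κ.map id + q = ν
      rw [Measure.map_id, add_comm, hqκ]
  · refine le_trans ?_ htε
    rw [Measure.add_apply, Measure.map_apply hmd hdiag]
    have h0 : (fun x : E => (x, x)) ⁻¹' {p : E × E | p.1 ≠ p.2} = ∅ := by
      ext x; simp
    rw [h0, measure_empty, zero_add, Measure.smul_apply, smul_eq_mul]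
    have h1 : p.prod q {p : E × E | p.1 ≠ p.2} ≤ t * t := by
      refine (measure_mono (Set.subset_univ _)).trans_eq ?_
      rw [← Set.univ_prod_univ, Measure.prod_prod, hqp]
    calc t⁻¹ * p.prod q {p : E × E | p.1 ≠ p.2} ≤ t⁻¹ * (t * t) := by gcongr
      _ = (t⁻¹ * t) * t := (mul_assoc _ _ _).symm
      _ ≤ 1 * t := by gcongr; exact ENNReal.inv_mul_le_one t
      _ = t := one_mul t

end TotalVariation

/-! ### Invariant measure and convergence to it -/

section Ergodic

variable {E : Type*} [MeasurableSpace E]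

/-- The powers of `K` keep the weight `W` bounded up to the additive constant `B`, and contract
oscillations relative to `1 + β W` by factors `a n → 0`. -/
structure WeightedErgodic (K : Kernel E E) (W : E → ℝ) (B β : ℝ) (a : ℕ → ℝ) : Prop where
  nonneg : ∀ x, 0 ≤ W x
  measurable : Measurable W
  const_nonneg : 0 ≤ B
  weight_pos : 0 < β
  rate_nonneg : ∀ n, 0 ≤ a n
  rate_tendsto : Tendsto a atTop (𝓝 0)
  integrable : ∀ n x, Integrable W ((K ^ n) x)
  integral_le : ∀ n x, ∫ y, W y ∂(K ^ n) x ≤ W x + B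
  contract : ∀ φ : E → ℝ, Measurable φ → ∀ A : ℝ,
      (∀ x y, |φ x - φ y| ≤ A * ((1 + β * W x) + (1 + β * W y))) → ∀ n x y,
      |∫ z, φ z ∂(K ^ n) x - ∫ z, φ z ∂(K ^ n) y| ≤
        a n * A * ((1 + β * W x) + (1 + β * W y))

theorem exists_weightedErgodic {K : Kernel E E} [IsMarkovKernel K] {W : E → ℝ}
    (hW0 : ∀ x, 0 ≤ W x)
    (hWm : Measurable W) (hWi : ∀ x, Integrable W (K x)) {lam b : ℝ} (hlam0 : 0 ≤ lam)
    (hlam1 : lam < 1) (hb : 0 ≤ b) (hdrift : ∀ x, ∫ y, W y ∂K x ≤ lam * W x + b)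
    {m : ℕ} (hm : m ≠ 0)
    (hmin : ∀ R : ℝ, ∃ ν : Measure E, IsFiniteMeasure ν ∧ ν ≠ 0 ∧
      ∀ x, W x ≤ R → ν ≤ (K ^ m) x) :
    ∃ B β a, WeightedErgodic K W B β a := by
  obtain ⟨β, hβ, a, ha0, ha, H⟩ := harris hW0 hWm hWi hlam0 hlam1 hb hdrift hm hmin
  have hB : 0 ≤ b / (1 - lam) := div_nonneg hb (by linarith)
  refine ⟨b / (1 - lam), β, a, hW0, hWm, hB, hβ, ha0, ha,
    fun n x => (drift_pow hW0 hWm hWi hlam0 hlam1 hdrift n x).1, fun n x => ?_, H⟩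
  refine (drift_pow hW0 hWm hWi hlam0 hlam1 hdrift n x).2.trans ?_
  have h1 : lam ^ n * W x ≤ W x := mul_le_of_le_one_left (hW0 x) (pow_le_one₀ hlam0 hlam1.le)
  have := mul_nonneg hB (pow_nonneg hlam0 n)
  linarith

lemma integral_comp_measure {κ : Kernel E E} {μ : Measure E} {φ : E → ℝ}
    (h : Integrable φ (κ ∘ₘ μ)) : ∫ z, φ z ∂(κ ∘ₘ μ) = ∫ x, ∫ z, φ z ∂κ x ∂μ := by
  rw [Measure.comp_eq_comp_const_apply] at h ⊢
  rw [Kernel.integral_comp h, Kernel.const_apply]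

lemma integrable_comp_of_integral_le {κ : Kernel E E} {W : E → ℝ} (hW0 : ∀ x, 0 ≤ W x)
    (hWm : Measurable W) (hi : ∀ x, Integrable W (κ x)) {B : ℝ}
    (hle : ∀ x, ∫ y, W y ∂κ x ≤ W x + B) {μ : Measure E} [IsProbabilityMeasure μ]
    (hμ : Integrable W μ) :
    Integrable W (κ ∘ₘ μ) ∧ ∫ x, W x ∂(κ ∘ₘ μ) ≤ ∫ x, W x ∂μ + B := by
  have hmeas : StronglyMeasurable fun y => ∫ z, W z ∂κ y :=
    hWm.stronglyMeasurable.integral_kernel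
  have hi2 : Integrable (fun y => ∫ z, W z ∂κ y) μ := by
    refine (hμ.add (integrable_const B)).mono' hmeas.aestronglyMeasurable
      (Eventually.of_forall fun y => ?_)
    rw [Real.norm_of_nonneg (integral_nonneg hW0)]
    exact hle y
  have hic : Integrable W (κ ∘ₘ μ) := by
    rw [Measure.integrable_comp_iff hWm.aestronglyMeasurable]
    refine ⟨Eventually.of_forall hi, hi2.congr (Eventually.of_forall fun y => ?_)⟩
    exact integral_congr_ae
      (Eventually.of_forall fun z => (Real.norm_of_nonneg (hW0 z)).symm)
  refine ⟨hic, ?_⟩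
  rw [integral_comp_measure hic]
  refine (integral_mono hi2 (hμ.add (integrable_const B)) hle).trans_eq ?_
  simp [integral_add hμ (integrable_const B)]

lemma integrable_weight {W : E → ℝ} {β : ℝ} {μ : Measure E} [IsFiniteMeasure μ]
    (hμ : Integrable W μ) (A : ℝ) : Integrable (fun x => A * (1 + β * W x)) μ :=
  ((integrable_const 1).add (hμ.const_mul β)).const_mul A

lemma comp_pow_add {K : Kernel E E} (μ : Measure E) (m n : ℕ) :
    ⇑(K ^ (m + n)) ∘ₘ μ = ⇑(K ^ m) ∘ₘ (⇑(K ^ n) ∘ₘ μ) := by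
  rw [Measure.comp_assoc, Kernel.pow_add]

namespace WeightedErgodic

variable {K : Kernel E E} {W : E → ℝ} {B β : ℝ} {a : ℕ → ℝ}

lemma integrable_comp (H : WeightedErgodic K W B β a) {μ : Measure E} [IsProbabilityMeasure μ]
    (hμ : Integrable W μ) (n : ℕ) :
    Integrable W (⇑(K ^ n) ∘ₘ μ) ∧ ∫ x, W x ∂(⇑(K ^ n) ∘ₘ μ) ≤ ∫ x, W x ∂μ + B :=
  integrable_comp_of_integral_le H.nonneg H.measurable (H.integrable n) (H.integral_le n) hμ

variable [IsMarkovKernel K]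

lemma contract_measure (H : WeightedErgodic K W B β a) {μ ν : Measure E}
    [IsProbabilityMeasure μ] [IsProbabilityMeasure ν] (hμ : Integrable W μ)
    (hν : Integrable W ν) {φ : E → ℝ} (hφ : Measurable φ) {A : ℝ}
    (hosc : ∀ x y, |φ x - φ y| ≤ A * ((1 + β * W x) + (1 + β * W y))) (n : ℕ) :
    |∫ z, φ z ∂(⇑(K ^ n) ∘ₘ μ) - ∫ z, φ z ∂(⇑(K ^ n) ∘ₘ ν)| ≤
      a n * A * ((1 + β * ∫ x, W x ∂μ) + (1 + β * ∫ x, W x ∂ν)) := by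
  have iφ : ∀ (r : Measure E) [IsProbabilityMeasure r], Integrable W r →
      Integrable φ (⇑(K ^ n) ∘ₘ r) := fun r _ hr =>
    integrable_of_oscillation hφ (fun x y => (hosc x y).trans_eq (mul_add _ _ _))
      (integrable_weight (H.integrable_comp hr n).1 A)
  rw [integral_comp_measure (iφ μ hμ), integral_comp_measure (iφ ν hν)]
  have h := abs_integral_sub_integral_le
    (hφ.stronglyMeasurable.integral_kernel (κ := K ^ n)).measurable
    (fun x y => (H.contract φ hφ A hosc n x y).trans_eq (mul_add _ _ _)) (p := μ) (q := ν)
    (by simp) (integrable_weight hμ _) (integrable_weight hν _)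
  have vw : ∀ (r : Measure E) [IsProbabilityMeasure r], Integrable W r →
      ∫ z, a n * A * (1 + β * W z) ∂r = a n * A * (1 + β * ∫ z, W z ∂r) := fun r _ hr => by
    rw [integral_const_mul, integral_add (integrable_const 1) (hr.const_mul β),
      integral_const_mul]
    simp
  rw [vw μ hμ, vw ν hν, ← mul_add] at h
  exact h

lemma abs_measureReal_sub_le (H : WeightedErgodic K W B β a) {μ ν : Measure E}
    [IsProbabilityMeasure μ] [IsProbabilityMeasure ν] (hμ : Integrable W μ)
    (hν : Integrable W ν) {A : Set E} (hA : MeasurableSet A) (n : ℕ) :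
    |(⇑(K ^ n) ∘ₘ μ).real A - (⇑(K ^ n) ∘ₘ ν).real A| ≤
      a n * ((1 + β * ∫ x, W x ∂μ) + (1 + β * ∫ x, W x ∂ν)) := by
  -- An indicator oscillates by at most `1`, which the constant part of the weight already covers.
  have hosc : ∀ x y, |A.indicator (1 : E → ℝ) x - A.indicator (1 : E → ℝ) y|
      ≤ 1 * ((1 + β * W x) + (1 + β * W y)) := fun x y => by
    have h0 : ∀ x, 0 ≤ A.indicator (1 : E → ℝ) x ∧ A.indicator (1 : E → ℝ) x ≤ 1 := fun x => by
      by_cases hx : x ∈ A <;> simp [hx]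
    have hx := mul_nonneg H.weight_pos.le (H.nonneg x)
    have hy := mul_nonneg H.weight_pos.le (H.nonneg y)
    rw [abs_le]
    constructor <;> linarith [(h0 x).1, (h0 x).2, (h0 y).1, (h0 y).2]
  have := H.contract_measure hμ hν (measurable_one.indicator hA) hosc n
  rwa [integral_indicator_one hA, integral_indicator_one hA, mul_one] at this

/-- Existence of an invariant probability measure that integrates the weight. -/
theorem exists_invariant (H : WeightedErgodic K W B β a) {μ : Measure E}
    [IsProbabilityMeasure μ] (hμ : Integrable W μ) :
    ∃ π : Measure E, IsProbabilityMeasure π ∧ Integrable W π ∧ ∀ n : ℕ, ⇑(K ^ n) ∘ₘ π = π := by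
  -- The laws at times `n` and `n + k` are the images under `K ^ n` of `μ` and of `K ^ k ∘ₘ μ`; the
  -- latter integrates `W` to at most `∫ W ∂μ + B`, whatever `k`.
  set ε : ℕ → ℝ := fun n =>
    a n * ((1 + β * ∫ x, W x ∂μ) + (1 + β * (∫ x, W x ∂μ + B))) with hεdef
  have hε : Tendsto ε atTop (𝓝 0) := by
    simpa using H.rate_tendsto.mul_const ((1 + β * ∫ x, W x ∂μ) + (1 + β * (∫ x, W x ∂μ + B)))
  obtain ⟨π, hπ, hlim⟩ := exists_measure_of_uniformly_cauchy (μ := fun n => ⇑(K ^ n) ∘ₘ μ) hε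
    (fun A hA n k => by
      rw [comp_pow_add]
      refine (H.abs_measureReal_sub_le hμ (H.integrable_comp hμ k).1 hA n).trans ?_
      have h1 := (H.integrable_comp hμ k).2
      have h2 := H.weight_pos.le
      have h3 := H.rate_nonneg n
      exact mul_le_mul_of_nonneg_left
        (by have := mul_le_mul_of_nonneg_left h1 h2; linarith) h3)
  have hset : ∀ A, MeasurableSet A → Tendsto (fun n => (⇑(K ^ n) ∘ₘ μ) A) atTop (𝓝 (π A)) :=
    fun A hA => tendsto_measure_of_abs_sub_le hε (hlim A hA)
  refine ⟨π, hπ, ⟨H.measurable.aestronglyMeasurable, ?_⟩, ?_⟩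
  · rw [hasFiniteIntegral_iff_ofReal (Eventually.of_forall H.nonneg)]
    refine (lintegral_le_liminf_of_setwise hset _).trans_lt ?_
    refine lt_of_le_of_lt (liminf_le_of_le (a := ENNReal.ofReal (∫ x, W x ∂μ + B)) ?_ ?_)
      ENNReal.ofReal_lt_top
    · isBoundedDefault
    · intro c hc
      obtain ⟨n, hn⟩ := hc.exists
      refine hn.trans ?_
      rw [← ofReal_integral_eq_lintegral_ofReal (H.integrable_comp hμ n).1
        (Eventually.of_forall H.nonneg)]
      exact ENNReal.ofReal_le_ofReal (H.integrable_comp hμ n).2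
  -- Fatou's lemma yields only `K ∘ₘ π ≤ π`; between probability measures this is equality.
  · have hinv : K ∘ₘ π = π := by
      refine Measure.eq_of_le_of_isProbabilityMeasure (Measure.le_iff.2 fun A hA => ?_)
      rw [Measure.bind_apply hA K.aemeasurable]
      refine (lintegral_le_liminf_of_setwise hset _).trans ?_
      have : ∀ n, ∫⁻ x, K x A ∂(⇑(K ^ n) ∘ₘ μ) = (⇑(K ^ (n + 1)) ∘ₘ μ) A := fun n => by
        rw [← Measure.bind_apply hA K.aemeasurable, add_comm, comp_pow_add, pow_one]
      simp_rw [this]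
      exact ((tendsto_add_atTop_iff_nat 1).2 (hset A hA)).liminf_eq.le
    intro n
    induction n with
    | zero => rw [pow_zero]; exact Measure.id_comp
    | succ n ih => rw [comp_pow_add, pow_one, hinv, ih]

/-- Convergence in total variation to an invariant measure. -/
theorem tendsto_dTV (H : WeightedErgodic K W B β a)
    (hdiag : MeasurableSet {p : E × E | p.1 ≠ p.2}) {μ π : Measure E}
    [IsProbabilityMeasure μ] [IsProbabilityMeasure π] (hμ : Integrable W μ)
    (hπ : Integrable W π) (hinv : ∀ n : ℕ, ⇑(K ^ n) ∘ₘ π = π) :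
    Tendsto (fun n => dTV (⇑(K ^ n) ∘ₘ μ) π) atTop (𝓝 0) := by
  set D := (1 + β * ∫ x, W x ∂μ) + (1 + β * ∫ x, W x ∂π)
  have h : Tendsto (fun n => ENNReal.ofReal (a n * D)) atTop (𝓝 0) := by
    have := ENNReal.tendsto_ofReal (H.rate_tendsto.mul_const D)
    simpa using this
  refine tendsto_of_tendsto_of_tendsto_of_le_of_le tendsto_const_nhds h (fun _ => zero_le)
    fun n => dTV_le_of_forall_abs_sub_le hdiag fun A hA => ?_
  have := H.abs_measureReal_sub_le hμ hπ hA n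
  rwa [hinv n] at this

/-- Pointwise convergence of the iterates on functions dominated by the weight. -/
lemma abs_integral_pow_sub_le (H : WeightedErgodic K W B β a) {π : Measure E}
    [IsProbabilityMeasure π] (hπ : Integrable W π) (hinv : ∀ n : ℕ, ⇑(K ^ n) ∘ₘ π = π)
    {φ : E → ℝ} (hφ : Measurable φ) {A : ℝ}
    (hosc : ∀ x y, |φ x - φ y| ≤ A * ((1 + β * W x) + (1 + β * W y))) (n : ℕ) (x : E) :
    |∫ z, φ z ∂(K ^ n) x - ∫ z, φ z ∂π| ≤
      a n * A * ((1 + β * W x) + (1 + β * ∫ x, W x ∂π)) := by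
  have hd : Integrable W (Measure.dirac x) :=
    integrable_dirac' H.measurable.stronglyMeasurable (by simp)
  have := H.contract_measure hd hπ hφ hosc n
  rwa [hinv n, Measure.dirac_bind (K ^ n).measurable,
    integral_dirac' _ _ H.measurable.stronglyMeasurable] at this

end WeightedErgodic

end Ergodic

/-! ### Law of large numbers from decay of correlations -/

section LawOfLargeNumbers

variable {Ω : Type*} [MeasurableSpace Ω]

lemma integral_sum_sq_le {P : Measure Ω} {Y : ℕ → Ω → ℝ} (hY : ∀ i, MemLp (Y i) 2 P) {a : ℕ → ℝ}
    (ha : ∀ n, 0 ≤ a n) {G : ℝ} (hG : 0 ≤ G)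
    (hcov : ∀ i k, |∫ ω, Y i ω * Y (i + k) ω ∂P| ≤ a k * G) (n : ℕ) :
    ∫ ω, (∑ j ∈ Finset.range n, Y j ω) ^ 2 ∂P ≤
      2 * G * n * ∑ k ∈ Finset.range n, a k := by
  induction n with
  | zero => simp
  | succ n ih =>
    have hS : MemLp (fun ω => ∑ j ∈ Finset.range n, Y j ω) 2 P :=
      memLp_finsetSum _ fun i _ => hY i
    have hint : ∀ j, Integrable (fun ω => Y j ω * Y n ω) P := fun j =>
      (hY j).integrable_mul (hY n)
    have e : ∫ ω, (∑ j ∈ Finset.range (n + 1), Y j ω) ^ 2 ∂P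
        = ∫ ω, (∑ j ∈ Finset.range n, Y j ω) ^ 2 ∂P
          + (2 * ∑ j ∈ Finset.range n, ∫ ω, Y j ω * Y n ω ∂P + ∫ ω, Y n ω * Y n ω ∂P) := by
      have : ∀ ω, (∑ j ∈ Finset.range (n + 1), Y j ω) ^ 2 = (∑ j ∈ Finset.range n, Y j ω) ^ 2
          + (2 * ∑ j ∈ Finset.range n, Y j ω * Y n ω + Y n ω * Y n ω) := fun ω => by
        rw [Finset.sum_range_succ, ← Finset.sum_mul]; ring
      simp_rw [this]
      have hsum : Integrable (fun ω => ∑ j ∈ Finset.range n, Y j ω * Y n ω) P :=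
        integrable_finsetSum _ fun j _ => hint j
      have hrest : Integrable
          (fun ω => 2 * ∑ j ∈ Finset.range n, Y j ω * Y n ω + Y n ω * Y n ω) P :=
        (hsum.const_mul 2).add (hint n)
      rw [integral_add hS.integrable_sq hrest,
        integral_add (hsum.const_mul 2) (hint n), integral_const_mul,
        integral_finsetSum _ fun j _ => hint j]
    have hcross : ∑ j ∈ Finset.range n, ∫ ω, Y j ω * Y n ω ∂P
        ≤ G * ∑ j ∈ Finset.range n, a (j + 1) := by
      -- The pair `(j, n)` has lag `n - j`, which runs through `1, …, n`; reflection orders the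
      -- lags.
      rw [← Finset.sum_range_reflect (fun j => a (j + 1)), Finset.mul_sum]
      refine Finset.sum_le_sum fun j hj => ?_
      have hj' := Finset.mem_range.1 hj
      have := hcov j (n - j)
      rw [Nat.add_sub_cancel' hj'.le] at this
      rw [show n - 1 - j + 1 = n - j by omega, mul_comm]
      exact (le_abs_self _).trans this
    have hlast : ∫ ω, Y n ω * Y n ω ∂P ≤ a 0 * G := (le_abs_self _).trans (hcov n 0)
    have hsucc := Finset.sum_range_succ' a n
    have hmono : ∑ k ∈ Finset.range n, a k ≤ ∑ k ∈ Finset.range (n + 1), a k := by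
      rw [Finset.sum_range_succ]; linarith [ha n]
    have h0 : 0 ≤ a 0 * G := mul_nonneg (ha 0) hG
    have h1 : 2 * G * n * ∑ k ∈ Finset.range n, a k
        ≤ 2 * G * n * ∑ k ∈ Finset.range (n + 1), a k := by gcongr
    rw [e]
    push_cast
    have h2 : 2 * (G * ∑ j ∈ Finset.range n, a (j + 1)) + a 0 * G
        ≤ 2 * G * ∑ k ∈ Finset.range (n + 1), a k := by
      rw [hsucc]; linarith
    linarith

variable {P : Measure Ω} [IsProbabilityMeasure P]

/-- Nonnegativity of the variance of `|f|`. -/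
lemma integral_abs_le_sqrt {f : Ω → ℝ} (hf : MemLp f 2 P) :
    ∫ ω, |f ω| ∂P ≤ √(∫ ω, f ω ^ 2 ∂P) := by
  have h := variance_nonneg |f| P
  rw [variance_eq_sub hf.abs] at h
  refine Real.le_sqrt_of_sq_le ?_
  have e : ∫ ω, (|f| ^ 2) ω ∂P = ∫ ω, f ω ^ 2 ∂P := by
    simp [sq_abs]
  have e' : ∫ ω, |f| ω ∂P = ∫ ω, |f ω| ∂P := rfl
  rw [e, e'] at h
  linarith

/-- The law of large numbers in `L¹` for a sequence with asymptotically vanishing correlations. -/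
theorem tendsto_integral_abs_average {Y : ℕ → Ω → ℝ} (hY : ∀ i, MemLp (Y i) 2 P) {a : ℕ → ℝ}
    (ha : ∀ n, 0 ≤ a n) (ha0 : Tendsto a atTop (𝓝 0)) {G : ℝ} (hG : 0 ≤ G)
    (hcov : ∀ i k, |∫ ω, Y i ω * Y (i + k) ω ∂P| ≤ a k * G) :
    Tendsto (fun n : ℕ => ∫ ω, |(∑ j ∈ Finset.range n, Y j ω) / n| ∂P) atTop (𝓝 0) := by
  -- The second moment of the average is at most a multiple of the Cesàro mean of `a`, so `a n → 0`
  -- suffices without summability.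
  have hlim : Tendsto (fun n : ℕ => √(2 * G * ((n : ℝ)⁻¹ * ∑ k ∈ Finset.range n, a k)))
      atTop (𝓝 0) := by
    have := (ha0.cesaro.const_mul (2 * G)).sqrt
    simpa using this
  refine squeeze_zero (fun n => integral_nonneg fun ω => abs_nonneg _) (fun n => ?_) hlim
  have hS : MemLp (fun ω => (∑ j ∈ Finset.range n, Y j ω) / n) 2 P := by
    simp_rw [div_eq_mul_inv]
    exact (memLp_finsetSum _ fun i _ => hY i).mul_const _
  refine (integral_abs_le_sqrt hS).trans (Real.sqrt_le_sqrt ?_)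
  simp_rw [div_pow]
  rw [integral_div]
  rcases Nat.eq_zero_or_pos n with rfl | hn
  · simp
  have hn' : (0 : ℝ) < n := by exact_mod_cast hn
  rw [div_le_iff₀ (by positivity)]
  refine (integral_sum_sq_le hY ha hG hcov n).trans_eq ?_
  field_simp

variable {E : Type*} [MeasurableSpace E]

/-- One constant `D` serves both as size and as decay constant of the centred function, as the
correlation bound requires. In `D`, the summand `A (1 + β + M)` pays for the decay and `C + |c|` for
the size. -/
lemma WeightedErgodic.exists_decay {K : Kernel E E} [IsMarkovKernel K] {W : E → ℝ}
    {B β : ℝ} {a : ℕ → ℝ} (H : WeightedErgodic K W B β a) {π : Measure E}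
    [IsProbabilityMeasure π] (hπ : Integrable W π) (hinv : ∀ n : ℕ, ⇑(K ^ n) ∘ₘ π = π)
    {φ : E → ℝ} (hφ : Measurable φ) {C : ℝ} (hC : 0 ≤ C) (hφC : ∀ x, |φ x| ≤ C * (1 + W x)) :
    ∃ D, 0 ≤ D ∧ (∀ x, |φ x - ∫ z, φ z ∂π| ≤ D * (1 + W x)) ∧
      ∀ k x, |∫ z, (φ z - ∫ z, φ z ∂π) ∂(K ^ k) x| ≤ a k * (D * (1 + W x)) := by
  have hβ := H.weight_pos
  obtain ⟨c, hc⟩ : ∃ c, c = ∫ x, φ x ∂π := ⟨_, rfl⟩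
  rw [← hc]
  -- This factor passes from the weight `1 + W` to `1 + β W`.
  obtain ⟨A, hA⟩ : ∃ A, A = C * (1 + 1 / β) := ⟨_, rfl⟩
  have hA0 : 0 ≤ A := by rw [hA]; positivity
  have hWβ : ∀ x, C * (1 + W x) ≤ A * (1 + β * W x) := fun x => by
    have hWx := H.nonneg x
    rw [hA, mul_assoc]
    refine mul_le_mul_of_nonneg_left ?_ hC
    have : (1 + 1 / β) * (1 + β * W x) = 1 + W x + (1 / β + β * W x) := by field_simp; ring
    rw [this]
    have : 0 ≤ 1 / β + β * W x := by positivity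
    linarith
  have hosc : ∀ x y, |φ x - φ y| ≤ A * ((1 + β * W x) + (1 + β * W y)) := fun x y => by
    rw [mul_add]
    exact (abs_sub _ _).trans (add_le_add ((hφC x).trans (hWβ x)) ((hφC y).trans (hWβ y)))
  obtain ⟨M, hM⟩ : ∃ M, M = 1 + β * ∫ x, W x ∂π := ⟨_, rfl⟩
  have hM0 : 0 ≤ M := by
    have := integral_nonneg (μ := π) (f := W) H.nonneg
    rw [hM]; positivity
  obtain ⟨D, hD⟩ : ∃ D, D = A * (1 + β + M) + (C + |c|) := ⟨_, rfl⟩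
  refine ⟨D, by rw [hD]; positivity, ?_, ?_⟩
  · intro x
    have hWx := H.nonneg x
    have h1 : |φ x - c| ≤ C * (1 + W x) + |c| := (abs_sub _ _).trans (add_le_add_left (hφC x) _)
    have h2 : |c| ≤ |c| * (1 + W x) := le_mul_of_one_le_right (abs_nonneg _) (by linarith)
    have h3 : 0 ≤ A * (1 + β + M) * (1 + W x) := by positivity
    rw [hD, add_mul, add_mul]; linarith
  · intro k x
    have hWx := H.nonneg x
    have iφ : Integrable φ ((K ^ k) x) :=
      integrable_of_oscillation hφ (fun x y => (hosc x y).trans_eq (mul_add _ _ _))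
        (integrable_weight (H.integrable k x) A)
    have e : ∫ z, (φ z - c) ∂(K ^ k) x = ∫ z, φ z ∂(K ^ k) x - c := by
      rw [integral_sub iφ (integrable_const c)]; simp
    rw [e, hc]
    refine (H.abs_integral_pow_sub_le hπ hinv hφ hosc k x).trans ?_
    rw [mul_assoc, ← hM]
    refine mul_le_mul_of_nonneg_left ?_ (H.rate_nonneg k)
    have h1 : 1 + β * W x + M ≤ (1 + β + M) * (1 + W x) := by
      have : 0 ≤ β + W x + M * W x := by positivity
      linarith
    have h2 : 0 ≤ (C + |c|) * (1 + W x) := by positivity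
    have h3 := mul_le_mul_of_nonneg_left h1 hA0
    rw [hD, add_mul, mul_assoc A]; linarith

/-- Conditioning on `X` replaces `ψ(Y)` by its conditional mean `∫ ψ ∂κ X`, which is small relative
to `U`. -/
lemma abs_integral_mul_le_of_compProd {κ : Kernel E E} [IsMarkovKernel κ] {X Y : Ω → E}
    (hX : Measurable X) (hY : Measurable Y)
    (hlaw : P.map (fun ω => (X ω, Y ω)) = (P.map X) ⊗ₘ κ) {ψ U : E → ℝ} (hψ : Measurable ψ)
    (hψX : MemLp (fun ω => ψ (X ω)) 2 P) (hψY : MemLp (fun ω => ψ (Y ω)) 2 P) {r : ℝ}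
    (hψU : ∀ x, |ψ x| ≤ U x) (hκU : ∀ x, |∫ z, ψ z ∂κ x| ≤ r * U x)
    (hU : MemLp (fun ω => U (X ω)) 2 P) :
    |∫ ω, ψ (X ω) * ψ (Y ω) ∂P| ≤ r * ∫ ω, U (X ω) ^ 2 ∂P := by
  have hpair : Measurable fun ω => (X ω, Y ω) := hX.prodMk hY
  have hprodm : Measurable fun p : E × E => ψ p.1 * ψ p.2 :=
    (hψ.comp measurable_fst).mul (hψ.comp measurable_snd)
  have hi0 : Integrable (fun ω => ψ (X ω) * ψ (Y ω)) P := hψX.integrable_mul hψY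
  have hi : Integrable (fun p : E × E => ψ p.1 * ψ p.2) ((P.map X) ⊗ₘ κ) := by
    rw [← hlaw, integrable_map_measure hprodm.aestronglyMeasurable hpair.aemeasurable]
    exact hi0
  have hprob : IsProbabilityMeasure (P.map X) := Measure.isProbabilityMeasure_map hX.aemeasurable
  have e1 : ∫ ω, ψ (X ω) * ψ (Y ω) ∂P = ∫ p, ψ p.1 * ψ p.2 ∂((P.map X) ⊗ₘ κ) := by
    rw [← hlaw]
    exact (integral_map hpair.aemeasurable hprodm.aestronglyMeasurable).symm
  have e2 : ∫ x, ψ x * ∫ z, ψ z ∂κ x ∂(P.map X) = ∫ ω, ψ (X ω) * ∫ z, ψ z ∂κ (X ω) ∂P :=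
    integral_map hX.aemeasurable (hψ.stronglyMeasurable.mul
      (hψ.stronglyMeasurable.integral_kernel (κ := κ))).aestronglyMeasurable
  rw [e1, Measure.integral_compProd hi]
  simp_rw [integral_const_mul]
  rw [e2, ← integral_const_mul, ← Real.norm_eq_abs]
  refine norm_integral_le_of_norm_le (hU.integrable_sq.const_mul r)
    (Eventually.of_forall fun ω => ?_)
  rw [Real.norm_eq_abs, abs_mul]
  refine (mul_le_mul (hψU _) (hκU _) (abs_nonneg _) ((abs_nonneg _).trans (hψU _))).trans_eq ?_
  ring

/-- The law of large numbers in `L¹` for a Markov chain with an ergodic kernel. -/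
theorem WeightedErgodic.tendsto_average {K : Kernel E E} [IsMarkovKernel K] {W : E → ℝ}
    {B β : ℝ} {a : ℕ → ℝ} (H : WeightedErgodic K W B β a) {π : Measure E}
    [IsProbabilityMeasure π] (hπ : Integrable W π) (hinv : ∀ n : ℕ, ⇑(K ^ n) ∘ₘ π = π)
    {Z : ℕ → Ω → E} (hZ : ∀ n, Measurable (Z n))
    (hlaw : ∀ i k, P.map (fun ω => (Z i ω, Z (i + k) ω)) = (P.map (Z i)) ⊗ₘ (K ^ k))
    {B₂ : ℝ} (hW2 : ∀ i, Integrable (fun ω => W (Z i ω) ^ 2) P ∧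
      ∫ ω, W (Z i ω) ^ 2 ∂P ≤ B₂)
    {φ : E → ℝ} (hφ : Measurable φ) {C : ℝ} (hC : 0 ≤ C) (hφC : ∀ x, |φ x| ≤ C * (1 + W x)) :
    Integrable φ π ∧ (∀ n, Integrable (fun ω => φ (Z n ω)) P) ∧
    Tendsto (fun n : ℕ => ∫ ω, |(∑ j ∈ Finset.Icc 1 n, φ (Z j ω)) / n - ∫ x, φ x ∂π| ∂P)
      atTop (𝓝 0) := by
  have iπ : Integrable φ π := (((integrable_const 1).add hπ).const_mul C).mono'
    hφ.aestronglyMeasurable (Eventually.of_forall hφC)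
  have hB₂ : 0 ≤ B₂ := (integral_nonneg fun ω => sq_nonneg _).trans (hW2 0).2
  obtain ⟨D, hD0, hψD, hKD⟩ := H.exists_decay hπ hinv hφ hC hφC
  obtain ⟨c, hc⟩ : ∃ c, c = ∫ x, φ x ∂π := ⟨_, rfl⟩
  rw [← hc] at hψD hKD ⊢
  obtain ⟨ψ, hψ⟩ : ∃ ψ : E → ℝ, ψ = fun x => φ x - c := ⟨_, rfl⟩
  have hψm : Measurable ψ := by rw [hψ]; exact hφ.sub_const c
  replace hψD : ∀ x, |ψ x| ≤ D * (1 + W x) := by rw [hψ]; exact hψD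
  replace hKD : ∀ k x, |∫ z, ψ z ∂(K ^ k) x| ≤ a k * (D * (1 + W x)) := by rw [hψ]; exact hKD
  have hW2mem : ∀ i, MemLp (fun ω => W (Z i ω)) 2 P := fun i => by
    have hm : Measurable fun ω => W (Z i ω) := H.measurable.comp (hZ i)
    exact (memLp_two_iff_integrable_sq hm.aestronglyMeasurable).2 (hW2 i).1
  have hUmem : ∀ i, MemLp (fun ω => D * (1 + W (Z i ω))) 2 P := fun i => by
    have h1 : MemLp (fun ω => 1 + W (Z i ω)) 2 P := (memLp_const (1 : ℝ)).add (hW2mem i)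
    exact h1.const_mul D
  have hYmem : ∀ i, MemLp (fun ω => ψ (Z i ω)) 2 P := fun i => by
    have hm : Measurable fun ω => ψ (Z i ω) := hψm.comp (hZ i)
    exact (hUmem i).mono' hm.aestronglyMeasurable (Eventually.of_forall fun ω => hψD _)
  have hU2 : ∀ i, ∫ ω, (D * (1 + W (Z i ω))) ^ 2 ∂P ≤ D ^ 2 * (2 + 2 * B₂) := fun i => by
    have hi : Integrable (fun ω => D ^ 2 * (2 + 2 * W (Z i ω) ^ 2)) P :=
      ((integrable_const 2).add ((hW2 i).1.const_mul 2)).const_mul _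
    refine (integral_mono (hUmem i).integrable_sq hi fun ω => ?_).trans ?_
    · simp only [mul_pow]
      refine mul_le_mul_of_nonneg_left ?_ (sq_nonneg D)
      nlinarith [sq_nonneg (1 - W (Z i ω))]
    · rw [integral_const_mul, integral_add (integrable_const 2) ((hW2 i).1.const_mul 2),
        integral_const_mul]
      refine mul_le_mul_of_nonneg_left ?_ (sq_nonneg D)
      have := (hW2 i).2
      simp only [integral_const, probReal_univ, smul_eq_mul, one_mul]
      linarith
  have hcov : ∀ i k, |∫ ω, ψ (Z i ω) * ψ (Z (i + k) ω) ∂P| ≤ a k * (D ^ 2 * (2 + 2 * B₂)) :=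
    fun i k => (abs_integral_mul_le_of_compProd (hZ i) (hZ (i + k)) (hlaw i k) hψm (hYmem i)
      (hYmem (i + k)) hψD (hKD k) (hUmem i)).trans
        (mul_le_mul_of_nonneg_left (hU2 i) (H.rate_nonneg k))
  refine ⟨iπ, fun n => ?_, ?_⟩
  · have := ((hYmem n).integrable one_le_two).add (integrable_const c)
    exact this.congr (Eventually.of_forall fun ω => by simp [hψ])
  · have hG : 0 ≤ D ^ 2 * (2 + 2 * B₂) := by positivity
    -- The averages start at time `1`, so the sequence is shifted by one.
    have key := tendsto_integral_abs_average (Y := fun i ω => ψ (Z (1 + i) ω))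
      (fun i => hYmem (1 + i)) H.rate_nonneg H.rate_tendsto hG
      (fun i k => by simpa only [add_assoc] using hcov (1 + i) k)
    refine key.congr' ?_
    filter_upwards [eventually_gt_atTop 0] with n hn
    have hn' : (n : ℝ) ≠ 0 := by exact_mod_cast hn.ne'
    have hsum : ∀ ω, ∑ j ∈ Finset.Icc 1 n, φ (Z j ω) = ∑ j ∈ Finset.range n, φ (Z (1 + j) ω) :=
      fun ω => by
        rw [show Finset.Icc 1 n = Finset.Ico 1 (n + 1) by ext; simp,
          Finset.sum_Ico_eq_sum_range, Nat.add_sub_cancel]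
    refine integral_congr_ae (Eventually.of_forall fun ω => ?_)
    simp only [hsum, hψ, Finset.sum_sub_distrib, Finset.sum_const, Finset.card_range, nsmul_eq_mul]
    congr 1
    field_simp

end LawOfLargeNumbers

/-! ### Markov chains as iterated random maps -/

section RandomMap

variable {E S : Type*} [MeasurableSpace E] [MeasurableSpace S]

/-- The transition kernel `x ↦ Law (G (x, w))`, `w ∼ ν`, of an iterated random map. -/
noncomputable def noiseKernel (ν : Measure S) (G : E × S → E) : Kernel E E :=
  (Kernel.id ×ₖ Kernel.const E ν).map G

lemma noiseKernel_apply (ν : Measure S) [SFinite ν] {G : E × S → E} (hG : Measurable G) (x : E) :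
    noiseKernel ν G x = ν.map (fun w => G (x, w)) := by
  rw [noiseKernel, Kernel.map_apply _ hG, Kernel.prod_apply, Kernel.id_apply, Kernel.const_apply,
    Measure.dirac_prod, Measure.map_map hG measurable_prodMk_left]
  rfl

lemma lintegral_noiseKernel (ν : Measure S) [SFinite ν] {G : E × S → E} (hG : Measurable G)
    (x : E) {f : E → ℝ≥0∞} (hf : Measurable f) :
    ∫⁻ y, f y ∂noiseKernel ν G x = ∫⁻ w, f (G (x, w)) ∂ν := by
  have hm : Measurable fun w => G (x, w) := hG.comp measurable_prodMk_left
  rw [noiseKernel_apply ν hG, lintegral_map hf hm]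

lemma isMarkovKernel_noiseKernel (ν : Measure S) [IsProbabilityMeasure ν] {G : E × S → E}
    (hG : Measurable G) : IsMarkovKernel (noiseKernel ν G) :=
  Kernel.IsMarkovKernel.map _ hG

instance isFiniteKernel_noiseKernel (ν : Measure S) [IsFiniteMeasure ν] (G : E × S → E) :
    IsFiniteKernel (noiseKernel ν G) := by
  unfold noiseKernel; infer_instance

variable {Ω : Type*} [MeasurableSpace Ω] {P : Measure Ω} [IsProbabilityMeasure P]

/-- The two-time laws of a chain driven by independent noise. -/
theorem map_pair_eq_compProd_pow {ν : Measure S} [IsProbabilityMeasure ν] {G : E × S → E}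
    (hG : Measurable G) {Z : ℕ → Ω → E} {w : ℕ → Ω → S} (hZ : ∀ n, Measurable (Z n))
    (hw : ∀ n, Measurable (w n)) (hstep : ∀ n ω, Z (n + 1) ω = G (Z n ω, w n ω))
    (hlaw : ∀ n, P.map (w n) = ν)
    (hind : ∀ i n, i ≤ n → IndepFun (fun ω => (Z i ω, Z n ω)) (w n) P) (i k : ℕ) :
    P.map (fun ω => (Z i ω, Z (i + k) ω)) = (P.map (Z i)) ⊗ₘ ((noiseKernel ν G) ^ k) := by
  have hprob : IsProbabilityMeasure (P.map (Z i)) :=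
    Measure.isProbabilityMeasure_map (hZ i).aemeasurable
  have hK : IsMarkovKernel (noiseKernel ν G) := isMarkovKernel_noiseKernel ν hG
  induction k with
  | zero =>
    have : (noiseKernel ν G) ^ 0 = Kernel.id := pow_zero _
    rw [this, Measure.compProd_id, Measure.map_map (by fun_prop) (hZ i)]
    rfl
  | succ k ih =>
    have hp : Measurable fun ω => (Z i ω, Z (i + k) ω) := (hZ i).prodMk (hZ _)
    have hT : Measurable fun q : (E × E) × S => (q.1.1, G (q.1.2, q.2)) := by fun_prop
    -- The new noise is independent of the pair at times `i` and `i + k`, so the next pair has the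
    -- image law of a product measure.
    have h1 : P.map (fun ω => (Z i ω, Z (i + (k + 1)) ω))
        = ((P.map (fun ω => (Z i ω, Z (i + k) ω))).prod ν).map
          (fun q : (E × E) × S => (q.1.1, G (q.1.2, q.2))) := by
      have := (indepFun_iff_map_prod_eq_prod_map_map hp.aemeasurable
        (hw (i + k)).aemeasurable).1 (hind i (i + k) (Nat.le_add_right _ _))
      rw [← hlaw (i + k), ← this, Measure.map_map hT (hp.prodMk (hw _))]
      congr 1
      funext ω
      simp only [Function.comp, ← add_assoc, hstep]
    rw [h1, ih]
    have hpow : (noiseKernel ν G) ^ (k + 1) = noiseKernel ν G ∘ₖ ((noiseKernel ν G) ^ k) := by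
      rw [add_comm, Kernel.pow_add, pow_one]
    refine Measure.ext_of_lintegral _ fun f hf => ?_
    have hfT : Measurable fun q : (E × E) × S => f (q.1.1, G (q.1.2, q.2)) := hf.comp hT
    rw [lintegral_map hf hT, lintegral_prod _ hfT.aemeasurable, hpow,
      Measure.lintegral_compProd hf]
    have hinner : Measurable fun q : E × E => ∫⁻ s, f (q.1, G (q.2, s)) ∂ν :=
      hfT.lintegral_prod_right'
    rw [Measure.lintegral_compProd hinner]
    refine lintegral_congr fun x => ?_
    have hfx : Measurable fun y => f (x, y) := hf.comp measurable_prodMk_left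
    rw [Kernel.lintegral_comp _ _ _ hfx]
    exact lintegral_congr fun y => (lintegral_noiseKernel ν hG y hfx).symm

lemma map_eq_pow_comp {ν : Measure S} [IsProbabilityMeasure ν] {G : E × S → E}
    (hG : Measurable G) {Z : ℕ → Ω → E} (hZ : ∀ n, Measurable (Z n))
    (hpair : ∀ i k, P.map (fun ω => (Z i ω, Z (i + k) ω)) =
      (P.map (Z i)) ⊗ₘ ((noiseKernel ν G) ^ k)) (n : ℕ) :
    P.map (Z n) = ⇑((noiseKernel ν G) ^ n) ∘ₘ P.map (Z 0) := by
  have hK : IsMarkovKernel (noiseKernel ν G) := isMarkovKernel_noiseKernel ν hG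
  have hprob : IsProbabilityMeasure (P.map (Z 0)) :=
    Measure.isProbabilityMeasure_map (hZ 0).aemeasurable
  rw [← Measure.snd_compProd, ← hpair, Measure.snd_map_prodMk (hZ 0), zero_add]

end RandomMap

/-! ### Rearranging independent pairs -/

section Independence

variable {Ω α β γ δ : Type*} [MeasurableSpace Ω] [MeasurableSpace α] [MeasurableSpace β]
  [MeasurableSpace γ] [MeasurableSpace δ]

lemma prod_prod_map_comm (A : Measure α) (B : Measure β) (C : Measure γ) (D : Measure δ)
    [SFinite A] [SFinite B] [SFinite C] [SFinite D] :
    ((A.prod B).prod (C.prod D)).map (fun p => ((p.1.1, p.2.1), (p.1.2, p.2.2))) =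
      (A.prod C).prod (B.prod D) := by
  refine Measure.ext_of_lintegral _ fun f hf => ?_
  have hm : Measurable fun p : (α × β) × (γ × δ) => ((p.1.1, p.2.1), (p.1.2, p.2.2)) := by
    fun_prop
  have hf' : Measurable fun p : (α × β) × (γ × δ) => f ((p.1.1, p.2.1), (p.1.2, p.2.2)) :=
    hf.comp hm
  have e1 : ∀ p : α × β, ∫⁻ q, f ((p.1, q.1), (p.2, q.2)) ∂(C.prod D)
      = ∫⁻ c, ∫⁻ d, f ((p.1, c), (p.2, d)) ∂D ∂C := fun p => by
    rw [lintegral_prod]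
    exact (hf.comp (show Measurable fun q : γ × δ => ((p.1, q.1), (p.2, q.2)) by
      fun_prop)).aemeasurable
  have e2 : ∀ p : α × γ, ∫⁻ q, f (p, q) ∂(B.prod D)
      = ∫⁻ b, ∫⁻ d, f (p, (b, d)) ∂D ∂B := fun p => by
    rw [lintegral_prod]
    exact (hf.comp (show Measurable fun q : β × δ => (p, q) by fun_prop)).aemeasurable
  rw [lintegral_map hf hm, lintegral_prod _ hf'.aemeasurable, lintegral_prod _ hf.aemeasurable]
  rw [lintegral_prod _ (Measurable.lintegral_prod_right' hf').aemeasurable,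
    lintegral_prod _ (Measurable.lintegral_prod_right' hf).aemeasurable]
  simp only [e2]
  refine lintegral_congr fun a =>
    (lintegral_congr fun b => e1 (a, b)).trans (lintegral_lintegral_swap ?_)
  have : Measurable fun q : (β × γ) × δ => f ((a, q.1.2), (q.1.1, q.2)) :=
    hf.comp (by fun_prop)
  exact this.lintegral_prod_right'.aemeasurable

/-- Exchange of the middle variables in independent pairs of independent variables. -/
lemma indepFun_prodMk_comm {P : Measure Ω} [IsProbabilityMeasure P] {a : Ω → α} {b : Ω → β}
    {c : Ω → γ} {d : Ω → δ} (ha : Measurable a) (hb : Measurable b) (hc : Measurable c)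
    (hd : Measurable d) (h : IndepFun (fun ω => (a ω, b ω)) (fun ω => (c ω, d ω)) P)
    (hab : IndepFun a b P) (hcd : IndepFun c d P) :
    IndepFun (fun ω => (a ω, c ω)) (fun ω => (b ω, d ω)) P := by
  have := Measure.isProbabilityMeasure_map (μ := P) ha.aemeasurable
  have := Measure.isProbabilityMeasure_map (μ := P) hb.aemeasurable
  have := Measure.isProbabilityMeasure_map (μ := P) hc.aemeasurable
  have := Measure.isProbabilityMeasure_map (μ := P) hd.aemeasurable
  rw [indepFun_iff_map_prod_eq_prod_map_map (ha.prodMk hb).aemeasurable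
    (hc.prodMk hd).aemeasurable,
    (indepFun_iff_map_prod_eq_prod_map_map ha.aemeasurable hb.aemeasurable).1 hab,
    (indepFun_iff_map_prod_eq_prod_map_map hc.aemeasurable hd.aemeasurable).1 hcd] at h
  have hm : Measurable fun p : (α × β) × (γ × δ) => ((p.1.1, p.2.1), (p.1.2, p.2.2)) := by
    fun_prop
  have key := congrArg (Measure.map fun p : (α × β) × (γ × δ) =>
    ((p.1.1, p.2.1), (p.1.2, p.2.2))) h
  rw [prod_prod_map_comm, Measure.map_map hm ((ha.prodMk hb).prodMk (hc.prodMk hd))] at key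
  have hac : P.map (fun ω => (a ω, c ω)) = (P.map a).prod (P.map c) := by
    have := congrArg Measure.fst key
    rw [Measure.fst_prod, Measure.fst, Measure.map_map measurable_fst
      (hm.comp ((ha.prodMk hb).prodMk (hc.prodMk hd)))] at this
    exact this
  have hbd : P.map (fun ω => (b ω, d ω)) = (P.map b).prod (P.map d) := by
    have := congrArg Measure.snd key
    rw [Measure.snd_prod, Measure.snd, Measure.map_map measurable_snd
      (hm.comp ((ha.prodMk hb).prodMk (hc.prodMk hd)))] at this
    exact this
  rw [indepFun_iff_map_prod_eq_prod_map_map (ha.prodMk hc).aemeasurable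
    (hb.prodMk hd).aemeasurable, hac, hbd]
  exact key

end Independence

/-! ### Lower bounds for Gaussian laws -/

section GaussianMinorization

/-- The outer measure behind `Measure.pi ν` is the largest one bounded on boxes by the product of
the factors, so a comparison on boxes suffices. -/
lemma pi_mono_measure {ι : Type*} [Fintype ι] {α : ι → Type*} [∀ i, MeasurableSpace (α i)]
    {μ ν : ∀ i, Measure (α i)} [∀ i, SigmaFinite (μ i)] [∀ i, SigmaFinite (ν i)]
    (h : ∀ i, μ i ≤ ν i) : Measure.pi μ ≤ Measure.pi ν := by
  refine Measure.le_iff.2 fun s hs => ?_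
  have hle : (Measure.pi μ).toOuterMeasure ≤
      OuterMeasure.pi fun i => (ν i).toOuterMeasure := by
    refine OuterMeasure.le_pi.2 fun t _ => ?_
    change Measure.pi μ (Set.univ.pi t) ≤ _
    rw [Measure.pi_pi]
    exact Finset.prod_le_prod' fun i _ => h i (t i)
  have e : Measure.pi ν s = (OuterMeasure.pi fun i => (ν i).toOuterMeasure) s := by
    rw [Measure.pi, toMeasure_apply _ _ hs]
  rw [e]
  exact hle s

/-- The uniform (unnormalized) measure on the cube `[-1, 1]^d`. -/
noncomputable def cubeMeasure (d : ℕ) : Measure (EuclideanSpace ℝ (Fin d)) :=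
  (Measure.pi fun _ : Fin d => (volume : Measure ℝ).restrict (Set.Icc (-1) 1)).map (WithLp.toLp 2)

lemma measurable_toLp_pi (d : ℕ) :
    Measurable (WithLp.toLp 2 : (Fin d → ℝ) → EuclideanSpace ℝ (Fin d)) := by
  fun_prop

lemma cubeMeasure_univ (d : ℕ) : cubeMeasure d Set.univ = 2 ^ d := by
  rw [cubeMeasure, Measure.map_apply (measurable_toLp_pi d) .univ, Set.preimage_univ,
    Measure.pi_univ]
  norm_num

instance isFiniteMeasure_cubeMeasure (d : ℕ) : IsFiniteMeasure (cubeMeasure d) :=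
  ⟨by rw [cubeMeasure_univ]; exact ENNReal.pow_lt_top (by simp)⟩

lemma ae_norm_le_cubeMeasure (d : ℕ) : ∀ᵐ y ∂cubeMeasure d, ‖y‖ ≤ √d := by
  rw [cubeMeasure, ae_map_iff (measurable_toLp_pi d).aemeasurable
    (measurableSet_le measurable_norm measurable_const)]
  have h : ∀ i : Fin d, ∀ᵐ x ∂(Measure.pi fun _ : Fin d =>
      (volume : Measure ℝ).restrict (Set.Icc (-1) 1)), x i ∈ Set.Icc (-1 : ℝ) 1 := fun i =>
    (Measure.quasiMeasurePreserving_eval _ i).ae (ae_restrict_mem measurableSet_Icc)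
  filter_upwards [ae_all_iff.2 h] with x hx
  rw [EuclideanSpace.norm_eq]
  refine Real.sqrt_le_sqrt ?_
  calc ∑ i, ‖x i‖ ^ 2 ≤ ∑ _i : Fin d, (1 : ℝ) := Finset.sum_le_sum fun i _ => by
        rw [Real.norm_eq_abs, sq_abs]
        have := (hx i).1; have := (hx i).2
        nlinarith
    _ = d := by simp

lemma gaussianReal_minorization {v : NNReal} (hv : v ≠ 0) (R : ℝ) :
    ∃ c : NNReal, 0 < c ∧ ∀ m : ℝ, |m| ≤ R →
      (c : ℝ≥0∞) • (volume : Measure ℝ).restrict (Set.Icc (-1) 1) ≤ gaussianReal m v := by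
  have hv' : (0 : ℝ) < v := by positivity
  -- The Gaussian density at distance `1 + R` from its mean; no point of `[-1, 1]` is farther from a
  -- mean in `[-R, R]`.
  set c₀ : ℝ := (√(2 * Real.pi * v))⁻¹ * Real.exp (-(1 + R) ^ 2 / (2 * v)) with hc₀
  have hc₀pos : 0 < c₀ := by positivity
  refine ⟨c₀.toNNReal, Real.toNNReal_pos.2 hc₀pos, fun m hm => ?_⟩
  rw [gaussianReal_of_var_ne_zero m hv, ← withDensity_const]
  refine Measure.le_iff.2 fun s hs => ?_
  rw [withDensity_apply _ hs, withDensity_apply _ hs, Measure.restrict_restrict hs]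
  refine (setLIntegral_mono_ae (measurable_gaussianPDF m v).aemeasurable ?_).trans
    (lintegral_mono_set Set.inter_subset_left)
  refine Eventually.of_forall fun x hx => ?_
  refine ENNReal.ofReal_le_ofReal ?_
  rw [hc₀, gaussianPDFReal]
  have h1 := abs_le.1 hm
  have h2 : (x - m) ^ 2 ≤ (1 + R) ^ 2 := by
    refine sq_le_sq' ?_ ?_ <;> linarith [hx.2.1, hx.2.2, h1.1, h1.2]
  gcongr

lemma pi_smul_measure {ι : Type*} [Fintype ι] {α : ι → Type*} [∀ i, MeasurableSpace (α i)]
    (μ : ∀ i, Measure (α i)) [∀ i, SigmaFinite (μ i)] (c : NNReal) :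
    Measure.pi (fun i => (c : ℝ≥0∞) • μ i) = ((c : ℝ≥0∞) ^ Fintype.card ι) • Measure.pi μ := by
  have hsf : ∀ i, SigmaFinite ((c : ℝ≥0∞) • μ i) := fun i =>
    inferInstanceAs (SigmaFinite (c • μ i))
  refine Measure.pi_eq fun s _ => ?_
  simp [Measure.pi_pi, Finset.prod_mul_distrib]

/-- Gaussians with bounded mean and fixed nonzero covariance `σ² I` are uniformly minorized. -/
lemma stdGaussian_minorization {d : ℕ} {σ : ℝ} (hσ : σ ≠ 0) (R : ℝ) :
    ∃ c : NNReal, 0 < c ∧ ∀ v : EuclideanSpace ℝ (Fin d), ‖v‖ ≤ R →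
      (c : ℝ≥0∞) • cubeMeasure d ≤
        (stdGaussian (EuclideanSpace ℝ (Fin d))).map (fun z => v + σ • z) := by
  have hvar : NNReal.mk (σ ^ 2) (sq_nonneg σ) ≠ 0 := by
    exact fun h => hσ (by simpa using congrArg NNReal.toReal h)
  obtain ⟨c, hc, hmin⟩ := gaussianReal_minorization hvar R
  refine ⟨c ^ d, pow_pos hc d, fun v hv => ?_⟩
  -- The coordinates are independent real Gaussians, which reduces the bound to dimension one and
  -- gives the constant `c ^ d`.
  have e : (stdGaussian (EuclideanSpace ℝ (Fin d))).map (fun z => v + σ • z) =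
      (Measure.pi fun i => gaussianReal (v i) (NNReal.mk (σ ^ 2) (sq_nonneg σ))).map (WithLp.toLp 2) := by
    have h1 : ∀ i, (gaussianReal 0 1).map (fun x => v i + σ * x)
        = gaussianReal (v i) (NNReal.mk (σ ^ 2) (sq_nonneg σ)) := fun i => by
      have : (fun x => v i + σ * x) = (fun x => v i + x) ∘ (fun x => σ * x) := rfl
      rw [this, ← Measure.map_map (by fun_prop) (by fun_prop), gaussianReal_map_const_mul,
        gaussianReal_map_const_add]
      simp
    simp_rw [← h1]
    rw [← map_pi_eq_stdGaussian, Measure.map_map (by fun_prop) (measurable_toLp_pi d),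
      ← Measure.pi_map_pi (fun i => by fun_prop), Measure.map_map (measurable_toLp_pi d)
        (by fun_prop)]
    rfl
  rw [e, cubeMeasure, ← Measure.map_smul]
  refine Measure.map_mono ?_ (measurable_toLp_pi d)
  have := pi_smul_measure (fun _ : Fin d => (volume : Measure ℝ).restrict (Set.Icc (-1) 1)) c
  rw [Fintype.card_fin] at this
  rw [ENNReal.coe_pow, ← this]
  have hsf : SigmaFinite ((c : ℝ≥0∞) • (volume : Measure ℝ).restrict (Set.Icc (-1) 1)) :=
    inferInstanceAs (SigmaFinite (c • (volume : Measure ℝ).restrict (Set.Icc (-1) 1)))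
  exact pi_mono_measure fun i => hmin (v i) ((PiLp.norm_apply_le v i).trans hv)

end GaussianMinorization

/-! ### Minorization for the SAGA-LD kernel -/

section SagaKernel

variable {d N : ℕ}

/-- The joint law of the drawn index and the Gaussian noise of one step. -/
noncomputable def sagaNoise (d N : ℕ) : Measure (Fin N × EuclideanSpace ℝ (Fin d)) :=
  ((N : ℝ≥0∞)⁻¹ • Measure.count).prod (stdGaussian (EuclideanSpace ℝ (Fin d)))

/-- One step of the chain as a map of the state and the noise. -/
noncomputable def sagaMap (F : Fin N → EuclideanSpace ℝ (Fin d) → EuclideanSpace ℝ (Fin d))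
    (η : ℝ) (p : State d N × (Fin N × EuclideanSpace ℝ (Fin d))) : State d N :=
  step F η p.1 p.2.1 p.2.2

/-- Replace the position, and refresh the `s`-th stored gradient at the old position. -/
def refreshMap (F : Fin N → EuclideanSpace ℝ (Fin d) → EuclideanSpace ℝ (Fin d)) (s : Fin N)
    (p : State d N × EuclideanSpace ℝ (Fin d)) : State d N :=
  (p.2, fun i => if s = i then F i p.1.1 else p.1.2 i)

/-- Minorant, up to a factor, of one step in which the index `s` is drawn. It has mass `2 ^ d`, so
it is not a Markov kernel in general. -/
noncomputable def refreshKernel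
    (F : Fin N → EuclideanSpace ℝ (Fin d) → EuclideanSpace ℝ (Fin d)) (s : Fin N) :
    Kernel (State d N) (State d N) :=
  noiseKernel (cubeMeasure d) (refreshMap F s)

/-- Refresh successively the gradients listed in `l`, each time drawing a new position from the
cube. -/
noncomputable def refreshChain
    (F : Fin N → EuclideanSpace ℝ (Fin d) → EuclideanSpace ℝ (Fin d)) :
    List (Fin N) → Kernel (State d N) (State d N)
  | [] => Kernel.id
  | s :: l => refreshChain F l ∘ₖ refreshKernel F s

variable {F : Fin N → EuclideanSpace ℝ (Fin d) → EuclideanSpace ℝ (Fin d)}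

lemma measurable_refreshMap (hF : ∀ i, Measurable (F i)) (s : Fin N) :
    Measurable (refreshMap F s) := by
  unfold refreshMap
  refine measurable_snd.prodMk (measurable_pi_lambda _ fun i => ?_)
  by_cases h : s = i
  · simp only [h, if_true]
    exact (hF i).comp (measurable_fst.comp measurable_fst)
  · simp only [h, if_false]
    fun_prop

lemma measurable_sagaMap (hF : ∀ i, Measurable (F i)) (η : ℝ) : Measurable (sagaMap F η) := by
  have h : ∀ s : Fin N, Measurable fun q : State d N × EuclideanSpace ℝ (Fin d) =>
      step F η q.1 s q.2 := by
    intro s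
    unfold step
    refine Measurable.prodMk ?_ ?_
    · have := hF s
      fun_prop
    · refine measurable_pi_lambda _ fun i => ?_
      by_cases hi : s = i
      · simp only [hi, if_true]
        exact (hF i).comp (measurable_fst.comp measurable_fst)
      · simp only [hi, if_false]
        fun_prop
  have h2 : Measurable fun q : Fin N × (State d N × EuclideanSpace ℝ (Fin d)) =>
      step F η q.2.1 q.1 q.2.2 := measurable_from_prod_countable_right fun s => h s
  exact h2.comp (g := _) (f := fun p : State d N × (Fin N × EuclideanSpace ℝ (Fin d)) =>
    (p.2.1, (p.1, p.2.2))) (by fun_prop)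

lemma isProbabilityMeasure_sagaNoise (hN : 0 < N) : IsProbabilityMeasure (sagaNoise d N) := by
  have h1 : IsProbabilityMeasure ((N : ℝ≥0∞)⁻¹ • (Measure.count : Measure (Fin N))) := ⟨by
    rw [Measure.smul_apply, Measure.count_univ]
    simp only [ENat.card_eq_coe_fintype_card, Fintype.card_fin, smul_eq_mul]
    exact ENNReal.inv_mul_cancel (by exact_mod_cast hN.ne') (by simp)⟩
  unfold sagaNoise
  infer_instance

instance isFiniteKernel_refreshKernel (s : Fin N) : IsFiniteKernel (refreshKernel F s) := by
  unfold refreshKernel; infer_instance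

instance isFiniteKernel_refreshChain (l : List (Fin N)) : IsFiniteKernel (refreshChain F l) := by
  induction l with
  | nil => exact inferInstanceAs (IsFiniteKernel Kernel.id)
  | cons s l ih => exact inferInstanceAs (IsFiniteKernel (refreshChain F l ∘ₖ refreshKernel F s))

lemma lintegral_refreshKernel (hF : ∀ i, Measurable (F i)) (s : Fin N) (u : State d N)
    {f : State d N → ℝ≥0∞} (hf : Measurable f) :
    ∫⁻ v, f v ∂refreshKernel F s u = ∫⁻ y, f (refreshMap F s (u, y)) ∂cubeMeasure d :=
  lintegral_noiseKernel _ (measurable_refreshMap hF s) u hf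

lemma refreshChain_cons_apply (hF : ∀ i, Measurable (F i)) (s : Fin N) (l : List (Fin N))
    (u : State d N) {A : Set (State d N)} (hA : MeasurableSet A) :
    refreshChain F (s :: l) u A
      = ∫⁻ y, refreshChain F l (refreshMap F s (u, y)) A ∂cubeMeasure d := by
  rw [refreshChain, Kernel.comp_apply' _ _ _ hA,
    lintegral_refreshKernel hF s u ((refreshChain F l).measurable_coe hA)]

/-- The refreshed chain forgets the stored gradients that it has refreshed. -/
lemma refreshChain_congr (hF : ∀ i, Measurable (F i)) (l : List (Fin N)) :
    ∀ u u' : State d N, u.1 = u'.1 → (∀ i, i ∉ l → u.2 i = u'.2 i) →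
      refreshChain F l u = refreshChain F l u' := by
  induction l with
  | nil =>
    intro u u' h1 h2
    have : u = u' := Prod.ext h1 (funext fun i => h2 i (List.not_mem_nil))
    rw [this]
  | cons s l ih =>
    intro u u' h1 h2
    refine Measure.ext fun A hA => ?_
    rw [refreshChain_cons_apply hF s l u hA, refreshChain_cons_apply hF s l u' hA]
    refine lintegral_congr fun y => ?_
    rw [ih (refreshMap F s (u, y)) (refreshMap F s (u', y)) rfl fun i hi => ?_]
    simp only [refreshMap]
    by_cases h : s = i
    · simp [h, h1]
    · simp only [h, if_false]
      exact h2 i (by simp [hi, Ne.symm h])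

/-- The refreshment by `s` erases the position, and `l` then overwrites every stored gradient. The
extra first index is needed because the gradient it stores is still evaluated at the initial
position; `l` contains `s` and replaces it. -/
lemma refreshChain_cons_eq (hF : ∀ i, Measurable (F i)) (s : Fin N) {l : List (Fin N)}
    (hl : ∀ i, i ∈ l) (u u' : State d N) :
    refreshChain F (s :: l) u = refreshChain F (s :: l) u' := by
  refine Measure.ext fun A hA => ?_
  rw [refreshChain_cons_apply hF s l u hA, refreshChain_cons_apply hF s l u' hA]
  refine lintegral_congr fun y => ?_
  rw [refreshChain_congr hF l (refreshMap F s (u, y)) (refreshMap F s (u', y)) rfl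
    fun i hi => absurd (hl i) hi]

lemma refreshChain_univ (hF : ∀ i, Measurable (F i)) (l : List (Fin N)) (u : State d N) :
    refreshChain F l u Set.univ = (2 ^ d) ^ l.length := by
  induction l generalizing u with
  | nil => simp [refreshChain]
  | cons s l ih =>
    rw [refreshChain_cons_apply hF s l u .univ]
    simp only [ih, lintegral_const, cubeMeasure_univ, List.length_cons, pow_succ]

/-- The first component of a step without noise. -/
noncomputable def driftPart (F : Fin N → EuclideanSpace ℝ (Fin d) → EuclideanSpace ℝ (Fin d))
    (η : ℝ) (u : State d N) (s : Fin N) : EuclideanSpace ℝ (Fin d) :=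
  u.1 - (η / N) • ∑ i, u.2 i - η • (F s u.1 - u.2 s)

lemma exists_norm_bound {M : ℝ} (hlip : ∀ i x y, ‖F i x - F i y‖ ≤ M * ‖x - y‖) :
    ∃ L, 0 ≤ L ∧ ∀ i x, ‖F i x‖ ≤ M * ‖x‖ + L := by
  refine ⟨∑ i, ‖F i 0‖, Finset.sum_nonneg fun i _ => norm_nonneg _, fun i x => ?_⟩
  have h1 := hlip i x 0
  rw [sub_zero] at h1
  have h2 : ‖F i 0‖ ≤ ∑ i, ‖F i 0‖ :=
    Finset.single_le_sum (f := fun i => ‖F i 0‖) (fun i _ => norm_nonneg _) (Finset.mem_univ i)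
  have h3 := norm_le_norm_add_norm_sub' (F i x) (F i 0)
  linarith

/-- The index `s` is drawn with probability `1/N`. Given this, the new memory is deterministic and
the new position is Gaussian, with a mean that is bounded for bounded `u`. -/
lemma sagaKernel_minorization (hN : 0 < N) {M : ℝ} (hM : 0 ≤ M)
    (hlip : ∀ i x y, ‖F i x - F i y‖ ≤ M * ‖x - y‖) (hF : ∀ i, Measurable (F i))
    {η : ℝ} (hη : 0 < η) (R : ℝ) :
    ∃ c : NNReal, 0 < c ∧ ∀ u : State d N, ‖u‖ ≤ R → ∀ s,
      (c : ℝ≥0∞) • refreshKernel F s u ≤ noiseKernel (sagaNoise d N) (sagaMap F η) u := by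
  obtain ⟨L, hL, hFL⟩ := exists_norm_bound hlip
  have hN' : (0 : ℝ) < N := by exact_mod_cast hN
  have hσ : √(2 * η) ≠ 0 := (Real.sqrt_pos.2 (by linarith)).ne'
  -- The radius bounds the mean: position, averaged memory and correction term contribute one
  -- summand each.
  obtain ⟨c, hc, hmin⟩ := stdGaussian_minorization (d := d) hσ
    (R + η * R + η * (M * R + L + R))
  refine ⟨(N : NNReal)⁻¹ * c, by positivity, fun u hu s => ?_⟩
  have hR : 0 ≤ R := (norm_nonneg u).trans hu
  have hu1 : ‖u.1‖ ≤ R := (norm_fst_le u).trans hu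
  have hu2 : ∀ i, ‖u.2 i‖ ≤ R := fun i => (norm_le_pi_norm u.2 i).trans ((norm_snd_le u).trans hu)
  have hv : ‖driftPart F η u s‖ ≤ R + η * R + η * (M * R + L + R) := by
    unfold driftPart
    have h1 : ‖(η / N) • ∑ i, u.2 i‖ ≤ η * R := by
      rw [norm_smul, Real.norm_of_nonneg (by positivity)]
      have : ‖∑ i, u.2 i‖ ≤ N * R := by
        refine (norm_sum_le _ _).trans ((Finset.sum_le_sum fun i _ => hu2 i).trans_eq ?_)
        simp
      calc η / N * ‖∑ i, u.2 i‖ ≤ η / N * (N * R) := by gcongr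
        _ = η * R := by field_simp
    have h2 : ‖η • (F s u.1 - u.2 s)‖ ≤ η * (M * R + L + R) := by
      rw [norm_smul, Real.norm_of_nonneg hη.le]
      refine mul_le_mul_of_nonneg_left ?_ hη.le
      refine (norm_sub_le _ _).trans (add_le_add ((hFL s u.1).trans ?_) (hu2 s))
      gcongr
    exact (norm_sub_le _ _).trans (add_le_add ((norm_sub_le _ _).trans (add_le_add hu1 h1)) h2)
  have hγ := hmin _ hv
  have hprob := isProbabilityMeasure_sagaNoise (d := d) hN
  refine Measure.le_iff.2 fun A hA => ?_
  have hmT : Measurable fun y => refreshMap F s (u, y) :=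
    (measurable_refreshMap hF s).comp measurable_prodMk_left
  have hmS : Measurable fun w => sagaMap F η (u, w) :=
    (measurable_sagaMap hF η).comp measurable_prodMk_left
  rw [Measure.smul_apply, refreshKernel, noiseKernel_apply _ (measurable_refreshMap hF s),
    noiseKernel_apply _ (measurable_sagaMap hF η), Measure.map_apply hmT hA,
    Measure.map_apply hmS hA]
  set B := (fun y => refreshMap F s (u, y)) ⁻¹' A
  have hB : MeasurableSet B := hmT hA
  have hma : Measurable fun z : EuclideanSpace ℝ (Fin d) => driftPart F η u s + √(2 * η) • z := by
    fun_prop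
  have h1 := hγ B
  rw [Measure.smul_apply, Measure.map_apply hma hB] at h1
  have hsub : {s} ×ˢ ((fun z => driftPart F η u s + √(2 * η) • z) ⁻¹' B) ⊆
      (fun w => sagaMap F η (u, w)) ⁻¹' A := by
    rintro ⟨s', z⟩ ⟨hs', hz⟩
    rw [Set.mem_singleton_iff] at hs'
    simp only at hs'
    subst hs'
    exact hz
  refine le_trans ?_ (measure_mono hsub)
  rw [sagaNoise, Measure.prod_prod, Measure.smul_apply, Measure.count_singleton, smul_eq_mul,
    smul_eq_mul, mul_one, ENNReal.coe_mul, ENNReal.coe_inv (by exact_mod_cast hN.ne'),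
    ENNReal.coe_natCast, mul_assoc]
  gcongr
  exact h1

lemma sagaKernel_pow_minorization (hN : 0 < N) {M : ℝ} (hM : 0 ≤ M)
    (hlip : ∀ i x y, ‖F i x - F i y‖ ≤ M * ‖x - y‖) (hF : ∀ i, Measurable (F i))
    {η : ℝ} (hη : 0 < η) (l : List (Fin N)) : ∀ R : ℝ,
    ∃ c : NNReal, 0 < c ∧ ∀ u : State d N, ‖u‖ ≤ R →
      (c : ℝ≥0∞) • refreshChain F l u ≤
        ((noiseKernel (sagaNoise d N) (sagaMap F η)) ^ l.length) u := by
  induction l with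
  | nil =>
    intro R
    refine ⟨1, one_pos, fun u _ => ?_⟩
    rw [ENNReal.coe_one, one_smul]
    exact le_rfl
  | cons s l ih =>
    intro R
    obtain ⟨L, hL, hFL⟩ := exists_norm_bound hlip
    obtain ⟨c₁, hc₁, h₁⟩ := sagaKernel_minorization (d := d) hN hM hlip hF hη R
    -- After a refreshment the state is again bounded: the position lies in the cube, kept gradients
    -- are at most `R`, and the new one is at most `M R + L`. So the one-step constants can be
    -- multiplied.
    obtain ⟨c₂, hc₂, h₂⟩ := ih (max √d (max R (M * R + L)))
    refine ⟨c₁ * c₂, mul_pos hc₁ hc₂, fun u hu => ?_⟩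
    have hR : 0 ≤ R := (norm_nonneg u).trans hu
    refine Measure.le_iff.2 fun A hA => ?_
    set K := noiseKernel (sagaNoise d N) (sagaMap F η)
    have hpow : K ^ (s :: l).length = (K ^ l.length) ∘ₖ K := by
      rw [List.length_cons, Kernel.pow_add, pow_one]
    rw [hpow, Kernel.comp_apply' _ _ _ hA, Measure.smul_apply, refreshChain_cons_apply hF s l u hA,
      smul_eq_mul]
    have hmeas : Measurable fun y => (K ^ l.length) y A := (K ^ l.length).measurable_coe hA
    calc ((c₁ * c₂ : NNReal) : ℝ≥0∞)
          * ∫⁻ y, refreshChain F l (refreshMap F s (u, y)) A ∂cubeMeasure d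
        = c₁ * ∫⁻ y, c₂ * refreshChain F l (refreshMap F s (u, y)) A ∂cubeMeasure d := by
          rw [lintegral_const_mul' _ _ ENNReal.coe_ne_top, ENNReal.coe_mul, mul_assoc]
      _ ≤ c₁ * ∫⁻ y, (K ^ l.length) (refreshMap F s (u, y)) A ∂cubeMeasure d := by
          refine mul_le_mul' le_rfl ?_
          refine lintegral_mono_ae ?_
          filter_upwards [ae_norm_le_cubeMeasure d] with y hy
          refine h₂ (refreshMap F s (u, y)) ?_ A
          refine (norm_prod_le_iff).2 ⟨hy.trans (le_max_left _ _), ?_⟩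
          refine (pi_norm_le_iff_of_nonneg ((Real.sqrt_nonneg _).trans (le_max_left _ _))).2
            fun i => ?_
          simp only [refreshMap]
          split_ifs
          · refine (hFL i u.1).trans (le_trans ?_ ((le_max_right _ _).trans (le_max_right _ _)))
            have := (norm_fst_le u).trans hu
            gcongr
          · exact ((norm_le_pi_norm u.2 i).trans ((norm_snd_le u).trans hu)).trans
              ((le_max_left _ _).trans (le_max_right _ _))
      _ = ∫⁻ y, (K ^ l.length) y A ∂((c₁ : ℝ≥0∞) • refreshKernel F s u) := by
          rw [lintegral_smul_measure, lintegral_refreshKernel hF s u hmeas, smul_eq_mul]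
      _ ≤ ∫⁻ y, (K ^ l.length) y A ∂K u := lintegral_mono' (h₁ u hu s) le_rfl

/-- The `(N + 1)`-step transition probabilities are uniformly minorized on bounded sets. -/
theorem exists_minorizing_measure (hN : 0 < N) {M : ℝ} (hM : 0 ≤ M)
    (hlip : ∀ i x y, ‖F i x - F i y‖ ≤ M * ‖x - y‖) (hF : ∀ i, Measurable (F i))
    {η : ℝ} (hη : 0 < η) (R : ℝ) :
    ∃ ν : Measure (State d N), IsFiniteMeasure ν ∧ ν ≠ 0 ∧ ∀ u : State d N, ‖u‖ ≤ R →
      ν ≤ ((noiseKernel (sagaNoise d N) (sagaMap F η)) ^ (N + 1)) u := by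
  -- An arbitrary first index, then all indices once: `N + 1` steps. The reference state `0` below
  -- is equally arbitrary, since the chain forgets where it started.
  obtain ⟨c, hc, h⟩ := sagaKernel_pow_minorization (d := d) hN hM hlip hF hη
    (⟨0, hN⟩ :: List.finRange N) R
  rw [List.length_cons, List.length_finRange] at h
  refine ⟨c • refreshChain F (⟨0, hN⟩ :: List.finRange N) 0, inferInstance, ?_, fun u hu => ?_⟩
  · intro h0
    have := congrArg (fun μ => μ Set.univ) h0
    simp [refreshChain_univ hF, hc.ne'] at this
  · rw [refreshChain_cons_eq hF _ (fun i => List.mem_finRange i) 0 u]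
    exact h u hu

end SagaKernel

/-! ### The Lyapunov drift condition -/

section Drift

variable {d N : ℕ}

lemma integrable_norm_sq_stdGaussian (d : ℕ) : Integrable (fun z => ‖z‖ ^ 2)
    (stdGaussian (EuclideanSpace ℝ (Fin d))) :=
  (IsGaussian.memLp_two_id (μ := stdGaussian (EuclideanSpace ℝ (Fin d)))).integrable_norm_pow
    two_ne_zero

/-- The second moment of a shifted and scaled standard Gaussian. -/
lemma integral_norm_add_smul_sq (y : EuclideanSpace ℝ (Fin d)) (σ : ℝ) :
    Integrable (fun z => ‖y + σ • z‖ ^ 2) (stdGaussian (EuclideanSpace ℝ (Fin d))) ∧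
    ∫ z, ‖y + σ • z‖ ^ 2 ∂stdGaussian (EuclideanSpace ℝ (Fin d)) =
      ‖y‖ ^ 2 + σ ^ 2 * ∫ z, ‖z‖ ^ 2 ∂stdGaussian (EuclideanSpace ℝ (Fin d)) := by
  set γ := stdGaussian (EuclideanSpace ℝ (Fin d))
  have hid : Integrable (fun z : EuclideanSpace ℝ (Fin d) => z) γ := IsGaussian.integrable_id
  have hin : Integrable (fun z => ⟪y, z⟫_ℝ) γ := hid.const_inner y
  have hsq : Integrable (fun z => ‖z‖ ^ 2) γ := integrable_norm_sq_stdGaussian d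
  have hexp : ∀ z : EuclideanSpace ℝ (Fin d),
      ‖y + σ • z‖ ^ 2 = ‖y‖ ^ 2 + (2 * σ * ⟪y, z⟫_ℝ + σ ^ 2 * ‖z‖ ^ 2) := fun z => by
    rw [norm_add_sq_real, real_inner_smul_right, norm_smul, mul_pow, Real.norm_eq_abs, sq_abs]
    ring
  have h0 : ∫ z, ⟪y, z⟫_ℝ ∂γ = 0 := by
    rw [integral_inner hid, integral_id_stdGaussian, inner_zero_right]
  have h1 : Integrable (fun z => 2 * σ * ⟪y, z⟫_ℝ + σ ^ 2 * ‖z‖ ^ 2) γ :=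
    (hin.const_mul _).add (hsq.const_mul _)
  simp_rw [hexp]
  refine ⟨(integrable_const _).add h1, ?_⟩
  rw [integral_add (integrable_const _) h1, integral_add (hin.const_mul _) (hsq.const_mul _),
    integral_const_mul, integral_const_mul, h0]
  simp

lemma integral_sagaNoise {h : Fin N × EuclideanSpace ℝ (Fin d) → ℝ} (hm : Measurable h)
    (hi : ∀ s, Integrable (fun z => h (s, z)) (stdGaussian (EuclideanSpace ℝ (Fin d))))
    (hN : 0 < N) :
    Integrable h (sagaNoise d N) ∧ ∫ w, h w ∂sagaNoise d N =
      (1 / (N : ℝ)) * ∑ s, ∫ z, h (s, z) ∂stdGaussian (EuclideanSpace ℝ (Fin d)) := by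
  have hfin : IsFiniteMeasure ((N : ℝ≥0∞)⁻¹ • (Measure.count : Measure (Fin N))) := by
    refine Measure.smul_finite _ (ENNReal.inv_ne_top.2 (by exact_mod_cast hN.ne'))
  have hint : Integrable h (sagaNoise d N) := by
    rw [sagaNoise, integrable_prod_iff hm.aestronglyMeasurable]
    exact ⟨Eventually.of_forall hi, Integrable.of_finite⟩
  refine ⟨hint, ?_⟩
  rw [sagaNoise] at hint ⊢
  rw [integral_prod _ hint, integral_smul_measure, integral_count, ENNReal.toReal_inv,
    ENNReal.toReal_natCast, smul_eq_mul, one_div]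

/-- The quadratic Lyapunov function of the chain. -/
noncomputable def lyapunov (κ : ℝ) (u : State d N) : ℝ := ‖u.1‖ ^ 2 + κ * ∑ i, ‖u.2 i‖ ^ 2

lemma lyapunov_nonneg {κ : ℝ} (hκ : 0 ≤ κ) (u : State d N) : 0 ≤ lyapunov κ u := by
  unfold lyapunov; positivity

lemma measurable_lyapunov (κ : ℝ) : Measurable (lyapunov κ : State d N → ℝ) := by
  unfold lyapunov; fun_prop

lemma euclNorm_le_lyapunov {κ : ℝ} (hκ : 0 < κ) (u : State d N) :
    euclNorm u ≤ √(1 + 1 / κ) * √(lyapunov κ u) := by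
  rw [euclNorm, ← Real.sqrt_mul (by positivity)]
  refine Real.sqrt_le_sqrt ?_
  have hQ : 0 ≤ ∑ i, ‖u.2 i‖ ^ 2 := Finset.sum_nonneg fun i _ => sq_nonneg _
  have : (1 + 1 / κ) * lyapunov κ u = ‖u.1‖ ^ 2 + ∑ i, ‖u.2 i‖ ^ 2
      + (1 / κ * ‖u.1‖ ^ 2 + κ * ∑ i, ‖u.2 i‖ ^ 2) := by
    unfold lyapunov; field_simp; ring
  rw [this]
  have : 0 ≤ 1 / κ * ‖u.1‖ ^ 2 + κ * ∑ i, ‖u.2 i‖ ^ 2 := by positivity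
  linarith

lemma norm_le_euclNorm (u : State d N) : ‖u‖ ≤ euclNorm u := by
  have hQ : 0 ≤ ∑ i, ‖u.2 i‖ ^ 2 := Finset.sum_nonneg fun i _ => sq_nonneg _
  refine norm_prod_le_iff.2 ⟨?_, (pi_norm_le_iff_of_nonneg (Real.sqrt_nonneg _)).2 fun i => ?_⟩
  · exact Real.le_sqrt_of_sq_le (by linarith)
  · have := Finset.single_le_sum (f := fun i => ‖u.2 i‖ ^ 2) (fun i _ => sq_nonneg _)
      (Finset.mem_univ i)
    refine Real.le_sqrt_of_sq_le ?_
    have := sq_nonneg ‖u.1‖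
    linarith

variable {F : Fin N → EuclideanSpace ℝ (Fin d) → EuclideanSpace ℝ (Fin d)}

/-- The stochastic gradient estimate used in one step. -/
noncomputable def sagaEstimate
    (F : Fin N → EuclideanSpace ℝ (Fin d) → EuclideanSpace ℝ (Fin d)) (u : State d N)
    (s : Fin N) : EuclideanSpace ℝ (Fin d) :=
  (1 / (N : ℝ)) • ∑ i, u.2 i + (F s u.1 - u.2 s)

lemma driftPart_eq (η : ℝ) (u : State d N) (s : Fin N) :
    driftPart F η u s = u.1 - η • sagaEstimate F u s := by
  rw [driftPart, sagaEstimate, smul_add, smul_smul, mul_one_div, sub_sub]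

/-- The estimate is unbiased. -/
lemma sum_sagaEstimate (hN : 0 < N) (u : State d N) :
    ∑ s, sagaEstimate F u s = ∑ s, F s u.1 := by
  have hN' : (N : ℝ) ≠ 0 := by exact_mod_cast hN.ne'
  simp only [sagaEstimate, Finset.sum_add_distrib, Finset.sum_sub_distrib, Finset.sum_const,
    Finset.card_univ, Fintype.card_fin]
  rw [← Nat.cast_smul_eq_nsmul ℝ, smul_smul, mul_one_div_cancel hN', one_smul]
  abel

lemma norm_sagaEstimate_sq_le (hN : 0 < N) (u : State d N) (s : Fin N) :
    ‖sagaEstimate F u s‖ ^ 2 ≤ 6 * ∑ i, ‖u.2 i‖ ^ 2 + 3 * ‖F s u.1‖ ^ 2 := by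
  have hN' : (0 : ℝ) < N := by exact_mod_cast hN
  set Q := ∑ i, ‖u.2 i‖ ^ 2 with hQ
  have hQ0 : 0 ≤ Q := Finset.sum_nonneg fun i _ => sq_nonneg _
  have hg : ∀ i, ‖u.2 i‖ ≤ √Q := fun i => Real.le_sqrt_of_sq_le
    (Finset.single_le_sum (f := fun i => ‖u.2 i‖ ^ 2) (fun i _ => sq_nonneg _)
      (Finset.mem_univ i))
  have hmean : ‖(1 / (N : ℝ)) • ∑ i, u.2 i‖ ≤ √Q := by
    rw [norm_smul, Real.norm_of_nonneg (by positivity)]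
    have : ‖∑ i, u.2 i‖ ≤ N * √Q := by
      refine (norm_sum_le _ _).trans ((Finset.sum_le_sum fun i _ => hg i).trans_eq ?_)
      simp
    calc 1 / (N : ℝ) * ‖∑ i, u.2 i‖ ≤ 1 / N * (N * √Q) := by gcongr
      _ = √Q := by field_simp
  -- The constants come from `(2q + f)² ≤ 6q² + 3f²`, that is, from `2(q - f)² ≥ 0`.
  have h1 : ‖sagaEstimate F u s‖ ≤ √Q + (‖F s u.1‖ + √Q) :=
    (norm_add_le _ _).trans (add_le_add hmean ((norm_sub_le _ _).trans
      (add_le_add le_rfl (hg s))))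
  have h2 := pow_le_pow_left₀ (norm_nonneg _) h1 2
  have h3 := Real.sq_sqrt hQ0
  nlinarith [sq_nonneg (√Q - ‖F s u.1‖)]

lemma sum_norm_ite_sq (u : State d N) (s : Fin N) :
    ∑ i, ‖(if s = i then F i u.1 else u.2 i)‖ ^ 2
      = ∑ i, ‖u.2 i‖ ^ 2 - ‖u.2 s‖ ^ 2 + ‖F s u.1‖ ^ 2 := by
  have h : ∀ i, ‖(if s = i then F i u.1 else u.2 i)‖ ^ 2
      = ‖u.2 i‖ ^ 2 + if s = i then ‖F i u.1‖ ^ 2 - ‖u.2 i‖ ^ 2 else 0 := fun i => by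
    split_ifs <;> ring
  simp_rw [h, Finset.sum_add_distrib, Finset.sum_ite_eq, Finset.mem_univ, if_true]
  ring

lemma integral_lyapunov_sagaKernel (hN : 0 < N) (hF : ∀ i, Measurable (F i)) {η : ℝ}
    (hη : 0 < η) (κ : ℝ) (u : State d N) :
    Integrable (lyapunov κ) (noiseKernel (sagaNoise d N) (sagaMap F η) u) ∧
    ∫ v, lyapunov κ v ∂noiseKernel (sagaNoise d N) (sagaMap F η) u =
      (1 / (N : ℝ)) * ∑ s, (‖driftPart F η u s‖ ^ 2
        + 2 * η * ∫ z, ‖z‖ ^ 2 ∂stdGaussian (EuclideanSpace ℝ (Fin d))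
        + κ * (∑ i, ‖u.2 i‖ ^ 2 - ‖u.2 s‖ ^ 2 + ‖F s u.1‖ ^ 2)) := by
  have hprob := isProbabilityMeasure_sagaNoise (d := d) hN
  have hmS : Measurable fun w => sagaMap F η (u, w) :=
    (measurable_sagaMap hF η).comp measurable_prodMk_left
  have hV : Measurable (lyapunov κ : State d N → ℝ) := measurable_lyapunov κ
  have hval : ∀ s z, lyapunov κ (sagaMap F η (u, (s, z))) =
      ‖driftPart F η u s + √(2 * η) • z‖ ^ 2
        + κ * (∑ i, ‖u.2 i‖ ^ 2 - ‖u.2 s‖ ^ 2 + ‖F s u.1‖ ^ 2) := fun s z => by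
    rw [← sum_norm_ite_sq]; rfl
  have hsec := fun s => integral_norm_add_smul_sq (driftPart F η u s) (√(2 * η))
  have key := integral_sagaNoise (hV.comp hmS) (fun s => by
    simp only [Function.comp_apply, hval]
    exact (hsec s).1.add (integrable_const _)) hN
  rw [noiseKernel_apply _ (measurable_sagaMap hF η),
    integrable_map_measure hV.aestronglyMeasurable hmS.aemeasurable,
    integral_map hmS.aemeasurable hV.aestronglyMeasurable]
  refine ⟨key.1, key.2.trans ?_⟩
  simp only [Function.comp_apply, hval]
  congr 1
  refine Finset.sum_congr rfl fun s _ => ?_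
  rw [integral_add (hsec s).1 (integrable_const _), (hsec s).2, Real.sq_sqrt (by linarith)]
  simp

lemma inv_mul_le_of_sum_le {n T Y e I J k Q : ℝ} (hn : 0 < n) (he : 0 ≤ e)
    (hT : T ≤ n * Y - e * I - k * Q) (hI : I ≥ n * J) :
    1 / n * T ≤ Y - e * J - k * (1 / n) * Q := by
  have h1 : e * (n * J) ≤ e * I := mul_le_mul_of_nonneg_left hI he
  rw [one_div_mul_eq_div, div_le_iff₀ hn]
  have h2 : k * (1 / n) * Q * n = k * Q := by field_simp
  nlinarith

/-- Dissipativity offers `-2ηc₂X`. The terms `6η²M²X` and `2κM²X` consume at most `ηc₂X/2` each,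
which leaves the factor `1 - ηc₂`. Refreshment offers `-κQ/n`, of which `6η²Q` consumes at most
half, which leaves `1 - 1/(2n)`. -/
lemma drift_arithmetic {η X Q α κ M c₁ c₂ L D lam n : ℝ} (hη : 0 < η) (hX0 : 0 ≤ X)
    (hQ0 : 0 ≤ Q) (hκ : κ = α * η) (hαM : 2 * α * M ^ 2 = c₂ / 2)
    (hη1 : 6 * η * M ^ 2 ≤ c₂ / 2) (hη2 : 6 * η ≤ α * (1 / (2 * n)))
    (h1 : 1 - η * c₂ ≤ lam) (h2 : 1 - 1 / (2 * n) ≤ lam) (hn : 0 < n) :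
    (X + η ^ 2 * (6 * Q + 6 * M ^ 2 * X + 6 * L ^ 2) + 2 * η * D
        + κ * (Q + (2 * M ^ 2 * X + 2 * L ^ 2))) - 2 * η * (c₂ * X - c₁) - κ * (1 / n) * Q
      ≤ lam * (X + κ * Q) + (2 * η * c₁ + 6 * η ^ 2 * L ^ 2 + 2 * η * D + 2 * κ * L ^ 2) := by
  have hα : 0 ≤ α := by
    have : 0 ≤ α * (1 / (2 * n)) := by linarith
    exact nonneg_of_mul_nonneg_left this (by positivity)
  have hκ0 : 0 ≤ κ := by rw [hκ]; positivity
  have hXc : (1 - η * c₂) * X ≤ lam * X := mul_le_mul_of_nonneg_right h1 hX0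
  have hQc : (1 - 1 / (2 * n)) * (κ * Q) ≤ lam * (κ * Q) :=
    mul_le_mul_of_nonneg_right h2 (by positivity)
  have k1 : η * X * (6 * η * M ^ 2) ≤ η * X * (c₂ / 2) :=
    mul_le_mul_of_nonneg_left hη1 (by positivity)
  have k2 : κ * (2 * M ^ 2 * X) = η * X * (c₂ / 2) := by rw [← hαM, hκ]; ring
  have k3 : η * Q * (6 * η) ≤ η * Q * (α * (1 / (2 * n))) :=
    mul_le_mul_of_nonneg_left hη2 (by positivity)
  have k4 : η * Q * (α * (1 / (2 * n))) = κ * Q * (1 / (2 * n)) := by rw [hκ]; ring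
  have k5 : κ * (1 / n) * Q = 2 * (κ * Q * (1 / (2 * n))) := by field_simp
  linarith

/-- The drift condition for small step sizes. -/
theorem exists_lyapunov_drift (hN : 0 < N) {M c₁ c₂ : ℝ} (hM : 0 < M) (hc₁ : 0 < c₁)
    (hc₂ : 0 < c₂) (hlip : ∀ i x y, ‖F i x - F i y‖ ≤ M * ‖x - y‖) (hF : ∀ i, Measurable (F i))
    (hdis : ∀ x, ⟪(1 / (N : ℝ)) • ∑ i, F i x, x⟫_ℝ ≥ c₂ * ‖x‖ ^ 2 - c₁) :
    ∃ η₀ : ℝ, 0 < η₀ ∧ ∀ η, 0 < η → η ≤ η₀ → ∃ κ lam b : ℝ, 0 < κ ∧ 0 ≤ lam ∧ lam < 1 ∧ 0 ≤ b ∧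
      ∀ u : State d N, ∫ v, lyapunov κ v ∂noiseKernel (sagaNoise d N) (sagaMap F η) u
        ≤ lam * lyapunov κ u + b := by
  have hN' : (0 : ℝ) < N := by exact_mod_cast hN
  have hN1 : (1 : ℝ) ≤ N := by exact_mod_cast hN
  obtain ⟨L, hL, hFL⟩ := exists_norm_bound hlip
  -- With `κ = αη`, the Lipschitz growth of a refreshed gradient costs exactly a quarter of the
  -- dissipation `2ηc₂`.
  obtain ⟨α, hα⟩ : ∃ α, α = c₂ / (4 * M ^ 2) := ⟨_, rfl⟩
  have hαM : 2 * α * M ^ 2 = c₂ / 2 := by rw [hα]; field_simp; ring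
  have hα0 : 0 < α := by rw [hα]; positivity
  refine ⟨min (c₂ / (12 * M ^ 2)) (α / (12 * N)), by positivity, fun η hη hη₀ => ?_⟩
  have hη1 : 6 * η * M ^ 2 ≤ c₂ / 2 := by
    have := (le_div_iff₀ (by positivity)).1 (hη₀.trans (min_le_left _ _))
    linarith
  have hη2 : 6 * η ≤ α * (1 / (2 * N)) := by
    have := (le_div_iff₀ (by positivity)).1 (hη₀.trans (min_le_right _ _))
    rw [mul_one_div, le_div_iff₀ (by positivity)]
    linarith
  obtain ⟨κ, hκ⟩ : ∃ κ, κ = α * η := ⟨_, rfl⟩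
  have hκ0 : 0 < κ := by rw [hκ]; positivity
  obtain ⟨D, hD⟩ : ∃ D, D = ∫ z, ‖z‖ ^ 2 ∂stdGaussian (EuclideanSpace ℝ (Fin d)) := ⟨_, rfl⟩
  have hD0 : 0 ≤ D := hD ▸ integral_nonneg fun z => sq_nonneg _
  have hNfrac : 1 / (2 * (N : ℝ)) ≤ 1 := by
    rw [div_le_one (by positivity)]; linarith
  refine ⟨κ, max (1 - η * c₂) (1 - 1 / (2 * N)), 2 * η * c₁ + 6 * η ^ 2 * L ^ 2 + 2 * η * D + 2 * κ * L ^ 2, hκ0,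
    le_max_of_le_right (by linarith), max_lt ?_ ?_, by positivity, fun u => ?_⟩
  · have := mul_pos hη hc₂; linarith
  · have : 0 < 1 / (2 * (N : ℝ)) := by positivity
    linarith
  rw [(integral_lyapunov_sagaKernel hN hF hη κ u).2, ← hD, lyapunov]
  set X := ‖u.1‖ ^ 2 with hX
  set Q := ∑ i, ‖u.2 i‖ ^ 2 with hQ
  have hX0 : 0 ≤ X := sq_nonneg _
  have hQ0 : 0 ≤ Q := Finset.sum_nonneg fun i _ => sq_nonneg _
  have hFsq : ∀ s, ‖F s u.1‖ ^ 2 ≤ 2 * M ^ 2 * X + 2 * L ^ 2 := fun s => by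
    have := pow_le_pow_left₀ (norm_nonneg _) (hFL s u.1) 2
    nlinarith [sq_nonneg (M * ‖u.1‖ - L)]
  have hest : ∀ s, ‖sagaEstimate F u s‖ ^ 2 ≤ 6 * Q + 6 * M ^ 2 * X + 6 * L ^ 2 := fun s => by
    have := norm_sagaEstimate_sq_le (F := F) hN u s
    have := hFsq s
    linarith
  have hterm : ∀ s, ‖driftPart F η u s‖ ^ 2 + 2 * η * D + κ * (Q - ‖u.2 s‖ ^ 2 + ‖F s u.1‖ ^ 2)
      ≤ (X + η ^ 2 * (6 * Q + 6 * M ^ 2 * X + 6 * L ^ 2) + 2 * η * D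
          + κ * (Q + (2 * M ^ 2 * X + 2 * L ^ 2)))
        - 2 * η * ⟪sagaEstimate F u s, u.1⟫_ℝ - κ * ‖u.2 s‖ ^ 2 := fun s => by
    rw [driftPart_eq, norm_sub_sq_real, real_inner_smul_right, norm_smul, mul_pow,
      Real.norm_eq_abs, sq_abs, real_inner_comm]
    have h1 := mul_le_mul_of_nonneg_left (hest s) (sq_nonneg η)
    have h2 := mul_le_mul_of_nonneg_left (hFsq s) hκ0.le
    linarith
  -- Only the mean gradient is dissipative, so the inner products are summed over the index before
  -- any bound; unbiasedness then removes the memory.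
  have hin : ∑ s, ⟪sagaEstimate F u s, u.1⟫_ℝ ≥ N * (c₂ * X - c₁) := by
    rw [← sum_inner, sum_sagaEstimate hN]
    have := hdis u.1
    rw [real_inner_smul_left, ge_iff_le, one_div, ← div_eq_inv_mul, le_div_iff₀ hN'] at this
    linarith
  have hsum := Finset.sum_le_sum fun s (_ : s ∈ (Finset.univ : Finset (Fin N))) => hterm s
  rw [Finset.sum_sub_distrib, Finset.sum_sub_distrib, ← Finset.mul_sum, ← Finset.mul_sum,
    Finset.sum_const, Finset.card_univ, Fintype.card_fin, nsmul_eq_mul, ← hQ] at hsum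
  have hdiv := inv_mul_le_of_sum_le hN' (show 0 ≤ 2 * η by positivity) hsum hin
  refine hdiv.trans (drift_arithmetic hη hX0 hQ0 hκ hαM hη1 hη2 (le_max_left _ _)
    (le_max_right _ _) hN')

end Drift

/-! ### Laws and independence along the chain -/

section Chain

variable {d N : ℕ} {Ω : Type*} {F : Fin N → EuclideanSpace ℝ (Fin d) → EuclideanSpace ℝ (Fin d)}
  {η : ℝ} {X₀ : Ω → EuclideanSpace ℝ (Fin d)} {S : ℕ → Ω → Fin N}
  {ξ : ℕ → Ω → EuclideanSpace ℝ (Fin d)}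

/-- The initial state together with the noise and the indices used before time `n`. -/
def chainPast (X₀ : Ω → EuclideanSpace ℝ (Fin d)) (S : ℕ → Ω → Fin N)
    (ξ : ℕ → Ω → EuclideanSpace ℝ (Fin d)) (n : ℕ) (ω : Ω) :
    EuclideanSpace ℝ (Fin d) × ((Finset.range (n + 1) → EuclideanSpace ℝ (Fin d)) ×
      (Finset.range n → Fin N)) :=
  (X₀ ω, (fun j => ξ j ω, fun j => S j ω))

/-- Time `i` involves the indices `S_j` with `j < i` and the noises `ξ_j` with `j ≤ i`; hence the
two ranges in `chainPast` differ by one. -/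
lemma chain_eq_comp_past (hF : ∀ i, Measurable (F i)) (n i : ℕ) (hi : i ≤ n) :
    ∃ g : EuclideanSpace ℝ (Fin d) × ((Finset.range (n + 1) → EuclideanSpace ℝ (Fin d)) ×
      (Finset.range n → Fin N)) → State d N, Measurable g ∧
      ∀ ω, chain F η X₀ S ξ i ω = g (chainPast X₀ S ξ n ω) := by
  induction i with
  | zero =>
    refine ⟨fun p => (p.1, fun i => F i p.1), ?_, fun ω => rfl⟩
    exact measurable_fst.prodMk (measurable_pi_lambda _ fun i => (hF i).comp measurable_fst)
  | succ i ih =>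
    obtain ⟨g, hg, hgω⟩ := ih (by omega)
    refine ⟨fun p => sagaMap F η (g p, (p.2.2 ⟨i, Finset.mem_range.2 (by omega)⟩,
      p.2.1 ⟨i + 1, Finset.mem_range.2 (by omega)⟩)), ?_, fun ω => ?_⟩
    · refine (measurable_sagaMap hF η).comp (hg.prodMk (Measurable.prodMk ?_ ?_))
      · exact (measurable_pi_apply _).comp (measurable_snd.comp measurable_snd)
      · exact (measurable_pi_apply _).comp (measurable_fst.comp measurable_snd)
    · change sagaMap F η (chain F η X₀ S ξ i ω, (S i ω, ξ (i + 1) ω)) = _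
      rw [hgω]
      rfl

variable [MeasurableSpace Ω] {P : Measure Ω} [IsProbabilityMeasure P]

lemma measurable_chain (hF : ∀ i, Measurable (F i)) (hX₀ : Measurable X₀)
    (hS : ∀ n, Measurable (S n)) (hξ : ∀ n, Measurable (ξ n)) (n : ℕ) :
    Measurable (chain F η X₀ S ξ n) := by
  induction n with
  | zero => exact hX₀.prodMk (measurable_pi_lambda _ fun i => (hF i).comp hX₀)
  | succ n ih =>
    change Measurable fun ω => sagaMap F η (chain F η X₀ S ξ n ω, (S n ω, ξ (n + 1) ω))
    exact (measurable_sagaMap hF η).comp (ih.prodMk ((hS n).prodMk (hξ (n + 1))))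

lemma map_noise_eq (hS_meas : ∀ n, Measurable (S n)) (hξ_meas : ∀ n, Measurable (ξ n))
    (hS_law : ∀ n i, P {ω | S n ω = i} = (N : ℝ≥0∞)⁻¹)
    (hξ_law : ∀ n, P.map (ξ n) = stdGaussian (EuclideanSpace ℝ (Fin d)))
    (hξS_indep : IndepFun (fun ω n => ξ n ω) (fun ω n => S n ω) P) (n : ℕ) :
    P.map (fun ω => (S n ω, ξ (n + 1) ω)) = sagaNoise d N := by
  have hi : IndepFun (S n) (ξ (n + 1)) P :=
    hξS_indep.symm.comp (measurable_pi_apply n) (measurable_pi_apply (n + 1))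
  rw [(indepFun_iff_map_prod_eq_prod_map_map (hS_meas n).aemeasurable
    (hξ_meas (n + 1)).aemeasurable).1 hi, hξ_law, sagaNoise]
  congr 1
  refine Measure.ext_of_singleton fun i => ?_
  rw [Measure.map_apply (hS_meas n) (measurableSet_singleton i), Measure.smul_apply,
    Measure.count_singleton, smul_eq_mul, mul_one]
  exact hS_law n i

/-- Past and present are independent within each of the two sequences, and the sequences are
independent of each other. Exchanging the middle variables regroups this by time; a second exchange
adjoins `X₀`. -/
lemma indepFun_past_noise (hX₀_meas : Measurable X₀) (hS_meas : ∀ n, Measurable (S n))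
    (hξ_meas : ∀ n, Measurable (ξ n)) (hS_indep : iIndepFun S P) (hξ_indep : iIndepFun ξ P)
    (hξS_indep : IndepFun (fun ω n => ξ n ω) (fun ω n => S n ω) P)
    (hX₀_indep : IndepFun X₀ (fun ω => ((fun n => ξ n ω), (fun n => S n ω))) P) (n : ℕ) :
    IndepFun (chainPast X₀ S ξ n) (fun ω => (S n ω, ξ (n + 1) ω)) P := by
  have mξ : Measurable fun ω (j : Finset.range (n + 1)) => ξ j ω :=
    measurable_pi_lambda _ fun j => hξ_meas j
  have mS : Measurable fun ω (j : Finset.range n) => S j ω :=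
    measurable_pi_lambda _ fun j => hS_meas j
  have iξ : IndepFun (fun ω (j : Finset.range (n + 1)) => ξ j ω) (ξ (n + 1)) P :=
    (hξ_indep.indepFun_finset (Finset.range (n + 1)) {n + 1} (by simp) hξ_meas).comp
      measurable_id (measurable_pi_apply (⟨n + 1, by simp⟩ : ({n + 1} : Finset ℕ)))
  have iS : IndepFun (fun ω (j : Finset.range n) => S j ω) (S n) P :=
    (hS_indep.indepFun_finset (Finset.range n) {n} (by simp) hS_meas).comp
      measurable_id (measurable_pi_apply (⟨n, by simp⟩ : ({n} : Finset ℕ)))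
  have iξS : IndepFun (fun ω => ((fun j : Finset.range (n + 1) => ξ j ω), ξ (n + 1) ω))
      (fun ω => ((fun j : Finset.range n => S j ω), S n ω)) P :=
    hξS_indep.comp
      (φ := fun x : ℕ → EuclideanSpace ℝ (Fin d) =>
        ((fun j : Finset.range (n + 1) => x j), x (n + 1)))
      (ψ := fun x : ℕ → Fin N => ((fun j : Finset.range n => x j), x n))
      (by fun_prop) (by fun_prop)
  have h1 := indepFun_prodMk_comm mξ (hξ_meas (n + 1)) mS (hS_meas n) iξS iξ iS
  -- The trivial partner of `X₀` brings the situation into the form of two pairs.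
  have h2 : IndepFun (fun ω => (X₀ ω, ()))
      (fun ω => (((fun j : Finset.range (n + 1) => ξ j ω), fun j : Finset.range n => S j ω),
        (ξ (n + 1) ω, S n ω))) P :=
    hX₀_indep.comp (φ := fun x : EuclideanSpace ℝ (Fin d) => (x, ()))
      (ψ := fun p : (ℕ → EuclideanSpace ℝ (Fin d)) × (ℕ → Fin N) =>
        (((fun j : Finset.range (n + 1) => p.1 j), fun j : Finset.range n => p.2 j),
          (p.1 (n + 1), p.2 n))) (by fun_prop) (by fun_prop)
  have h3 := indepFun_prodMk_comm hX₀_meas measurable_const (mξ.prodMk mS)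
    ((hξ_meas (n + 1)).prodMk (hS_meas n)) h2 (indepFun_const_right _ _) h1
  exact h3.comp measurable_id
    (ψ := fun q : Unit × (EuclideanSpace ℝ (Fin d) × Fin N) => (q.2.2, q.2.1)) (by fun_prop)

lemma map_chain_pair (hF : ∀ i, Measurable (F i)) (hN : 0 < N) (hX₀_meas : Measurable X₀)
    (hS_meas : ∀ n, Measurable (S n)) (hξ_meas : ∀ n, Measurable (ξ n))
    (hS_law : ∀ n i, P {ω | S n ω = i} = (N : ℝ≥0∞)⁻¹) (hS_indep : iIndepFun S P)
    (hξ_law : ∀ n, P.map (ξ n) = stdGaussian (EuclideanSpace ℝ (Fin d)))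
    (hξ_indep : iIndepFun ξ P)
    (hξS_indep : IndepFun (fun ω n => ξ n ω) (fun ω n => S n ω) P)
    (hX₀_indep : IndepFun X₀ (fun ω => ((fun n => ξ n ω), (fun n => S n ω))) P) (i k : ℕ) :
    P.map (fun ω => (chain F η X₀ S ξ i ω, chain F η X₀ S ξ (i + k) ω)) =
      (P.map (chain F η X₀ S ξ i)) ⊗ₘ ((noiseKernel (sagaNoise d N) (sagaMap F η)) ^ k) := by
  have hprob := isProbabilityMeasure_sagaNoise (d := d) hN
  refine map_pair_eq_compProd_pow (w := fun n ω => (S n ω, ξ (n + 1) ω))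
    (measurable_sagaMap hF η) (measurable_chain hF hX₀_meas hS_meas hξ_meas)
    (fun n => (hS_meas n).prodMk (hξ_meas (n + 1))) (fun n ω => rfl)
    (map_noise_eq hS_meas hξ_meas hS_law hξ_law hξS_indep) (fun i n hin => ?_) i k
  obtain ⟨g, hg, hgω⟩ := chain_eq_comp_past (η := η) (X₀ := X₀) (S := S) (ξ := ξ) hF n i hin
  obtain ⟨g', hg', hgω'⟩ := chain_eq_comp_past (η := η) (X₀ := X₀) (S := S) (ξ := ξ) hF n n le_rfl
  have := (indepFun_past_noise hX₀_meas hS_meas hξ_meas hS_indep hξ_indep hξS_indep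
    hX₀_indep n).comp (hg.prodMk hg') measurable_id
  simp_rw [hgω, hgω']
  exact this

lemma integrable_lyapunov_initial (hF : ∀ i, Measurable (F i)) (hX₀ : Measurable X₀)
    (hinit : Integrable (fun ω => ‖X₀ ω‖ ^ 2) P) {M : ℝ}
    (hlip : ∀ i x y, ‖F i x - F i y‖ ≤ M * ‖x - y‖) (κ : ℝ) :
    Integrable (fun ω => lyapunov κ (chain F η X₀ S ξ 0 ω)) P := by
  obtain ⟨L, hL, hFL⟩ := exists_norm_bound hlip
  refine hinit.add (Integrable.const_mul (integrable_finsetSum _ fun i _ => ?_) κ)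
  have hm : Measurable fun ω => ‖F i (X₀ ω)‖ ^ 2 := ((hF i).comp hX₀).norm.pow_const 2
  refine ((hinit.const_mul (2 * M ^ 2)).add (integrable_const (2 * L ^ 2))).mono'
    hm.aestronglyMeasurable (Eventually.of_forall fun ω => ?_)
  rw [Real.norm_of_nonneg (sq_nonneg _)]
  have := pow_le_pow_left₀ (norm_nonneg _) (hFL i (X₀ ω)) 2
  change ‖F i (X₀ ω)‖ ^ 2 ≤ 2 * M ^ 2 * ‖X₀ ω‖ ^ 2 + 2 * L ^ 2
  nlinarith [sq_nonneg (M * ‖X₀ ω‖ - L)]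

end Chain

/-! ### Convergence in probability, square-root weights and the theorem -/

lemma tendstoInMeasure_of_tendsto_integral_abs {Ω : Type*} [MeasurableSpace Ω] {P : Measure Ω}
    {f : ℕ → Ω → ℝ} {c : ℝ} (hf : ∀ n, Integrable (fun ω => f n ω - c) P)
    (hfm : ∀ n, Measurable (f n))
    (h : Tendsto (fun n => ∫ ω, |f n ω - c| ∂P) atTop (𝓝 0)) :
    TendstoInMeasure P f atTop (fun _ => c) := by
  refine tendstoInMeasure_of_tendsto_eLpNorm one_ne_zero
    (fun n => (hfm n).aestronglyMeasurable) aestronglyMeasurable_const ?_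
  have : ∀ n, eLpNorm (f n - fun _ => c) 1 P = ENNReal.ofReal (∫ ω, |f n ω - c| ∂P) := fun n => by
    rw [eLpNorm_one_eq_lintegral_enorm]
    exact (ofReal_integral_norm_eq_lintegral_enorm (hf n)).symm
  simp_rw [this]
  simpa using ENNReal.tendsto_ofReal h

/-- Square roots of quadratic Lyapunov functions satisfy a drift condition. -/
lemma integral_sqrt_le {E : Type*} [MeasurableSpace E] {ν : Measure E} [IsProbabilityMeasure ν]
    {V : E → ℝ} (hV0 : ∀ x, 0 ≤ V x) (hVm : Measurable V) (hV : Integrable V ν) {lam b v : ℝ}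
    (hlam : 0 ≤ lam) (hb : 0 ≤ b) (hv : 0 ≤ v) (h : ∫ x, V x ∂ν ≤ lam * v + b) :
    Integrable (fun x => √(V x)) ν ∧ ∫ x, √(V x) ∂ν ≤ √lam * √v + √b := by
  have hsq : ∀ x, √(V x) ^ 2 = V x := fun x => Real.sq_sqrt (hV0 x)
  have hmem : MemLp (fun x => √(V x)) 2 ν :=
    (memLp_two_iff_integrable_sq hVm.sqrt.aestronglyMeasurable).2 (by simpa only [hsq] using hV)
  refine ⟨hmem.integrable one_le_two, ?_⟩
  have h1 := integral_abs_le_sqrt hmem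
  simp only [abs_of_nonneg (Real.sqrt_nonneg _), hsq] at h1
  refine h1.trans ((Real.sqrt_le_sqrt h).trans ?_)
  rw [← Real.sqrt_mul hlam]
  refine Real.sqrt_le_iff.2 ⟨by positivity, ?_⟩
  have h2 := Real.sq_sqrt (mul_nonneg hlam hv)
  have h3 := Real.sq_sqrt hb
  have h4 := mul_nonneg (Real.sqrt_nonneg (lam * v)) (Real.sqrt_nonneg b)
  nlinarith

end SagaLD

theorem theorem1 {d N : ℕ} (hN : 0 < N)
    {Ω : Type*} [MeasurableSpace Ω] (P : Measure Ω) [IsProbabilityMeasure P]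
    -- the drift functions, the initial state, the drawn indices and the noise
    (F : Fin N → EuclideanSpace ℝ (Fin d) → EuclideanSpace ℝ (Fin d))
    (X₀ : Ω → EuclideanSpace ℝ (Fin d))
    (S : ℕ → Ω → Fin N)
    (ξ : ℕ → Ω → EuclideanSpace ℝ (Fin d))
    (hX₀_meas : Measurable X₀)
    (hS_meas : ∀ n, Measurable (S n))
    (hξ_meas : ∀ n, Measurable (ξ n))
    -- `S_n` are i.i.d. uniform on the index set, `ξ_n` are i.i.d. standard Gaussian
    (hS_law : ∀ n i, P {ω | S n ω = i} = (N : ℝ≥0∞)⁻¹)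
    (hS_indep : iIndepFun S P)
    (hξ_law : ∀ n, P.map (ξ n) = stdGaussian (EuclideanSpace ℝ (Fin d)))
    (hξ_indep : iIndepFun ξ P)
    -- the three objects `X₀`, `(ξ_n)_n`, `(S_n)_n` are (mutually) independent
    (hξS_indep : IndepFun (fun ω n => ξ n ω) (fun ω n => S n ω) P)
    (hX₀_indep : IndepFun X₀ (fun ω => ((fun n => ξ n ω), (fun n => S n ω))) P)
    -- square-integrable initial state, dissipativity, Lipschitz continuity
    (hinit : Integrable (fun ω => ‖X₀ ω‖ ^ 2) P)
    (hdissip : ∃ c₁ : ℝ, 0 < c₁ ∧ ∃ c₂ : ℝ, 0 < c₂ ∧ ∀ x : EuclideanSpace ℝ (Fin d),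
      ⟪(1 / (N : ℝ)) • ∑ i, F i x, x⟫_ℝ ≥ c₂ * ‖x‖ ^ 2 - c₁)
    (hlip : ∃ M : ℝ, 0 < M ∧ ∀ (i : Fin N) (x y : EuclideanSpace ℝ (Fin d)),
      ‖F i x - F i y‖ ≤ M * ‖x - y‖) :
    ∃ η₀ : ℝ, 0 < η₀ ∧ ∀ η : ℝ, 0 < η → η ≤ η₀ →
      ∃ μs : Measure (SagaLD.State d N), IsProbabilityMeasure μs ∧
        -- convergence of the laws in total variation
        Tendsto (fun n => SagaLD.dTV (P.map (SagaLD.chain F η X₀ S ξ n)) μs) atTop (𝓝 0) ∧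
        -- law of large numbers
        ∀ φ : SagaLD.State d N → ℝ, Measurable φ →
          (∃ C : ℝ, 0 < C ∧ ∀ u, |φ u| ≤ C * (1 + SagaLD.euclNorm u)) →
          Integrable φ μs ∧
          (∀ n, Integrable (fun ω => φ (SagaLD.chain F η X₀ S ξ n ω)) P) ∧
          Tendsto (fun n : ℕ =>
              ∫ ω, |SagaLD.ergodicAverage φ (SagaLD.chain F η X₀ S ξ) n ω - ∫ u, φ u ∂μs| ∂P)
            atTop (𝓝 0) ∧
          TendstoInMeasure P
            (fun n => SagaLD.ergodicAverage φ (SagaLD.chain F η X₀ S ξ) n) atTop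
            (fun _ => ∫ u, φ u ∂μs) := by
  obtain ⟨c₁, hc₁, c₂, hc₂, hdis⟩ := hdissip
  obtain ⟨M, hM, hlip⟩ := hlip
  have hF : ∀ i, Measurable (F i) := fun i =>
    (LipschitzWith.of_dist_le_mul (K := ⟨M, hM.le⟩) fun x y => by
      rw [dist_eq_norm, dist_eq_norm]; exact hlip i x y).continuous.measurable
  obtain ⟨η₀, hη₀, hdrift⟩ := SagaLD.exists_lyapunov_drift hN hM hc₁ hc₂ hlip hF hdis
  refine ⟨η₀, hη₀, fun η hη hηle => ?_⟩
  obtain ⟨κ, lam, b, hκ, hlam0, hlam1, hb, hV⟩ := hdrift η hη hηle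
  have hVi := fun u => (SagaLD.integral_lyapunov_sagaKernel hN hF hη κ u).1
  have hprob := SagaLD.isProbabilityMeasure_sagaNoise (d := d) hN
  set K := SagaLD.noiseKernel (SagaLD.sagaNoise d N) (SagaLD.sagaMap F η) with hK
  have hKm : IsMarkovKernel K :=
    SagaLD.isMarkovKernel_noiseKernel _ (SagaLD.measurable_sagaMap hF η)
  have hV0 := SagaLD.lyapunov_nonneg (d := d) (N := N) hκ.le
  have hVm := SagaLD.measurable_lyapunov (d := d) (N := N) κ
  have hW := fun u => SagaLD.integral_sqrt_le hV0 hVm (hVi u) hlam0 hb (hV0 u) (hV u)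
  have hnorm : ∀ u : SagaLD.State d N, SagaLD.euclNorm u ≤ √(1 + 1 / κ) * √(SagaLD.lyapunov κ u) :=
    SagaLD.euclNorm_le_lyapunov hκ
  have hWm : Measurable fun u : SagaLD.State d N => √(SagaLD.lyapunov κ u) := hVm.sqrt
  -- The weight is `√V` instead of `V`: linear growth is all that `φ` needs, and second moments of
  -- the weight are then first moments of `V`, which the drift controls from `E[|X₀|²] < ∞`.
  obtain ⟨B, β, a, H⟩ := SagaLD.exists_weightedErgodic (K := K)
    (W := fun u => √(SagaLD.lyapunov κ u)) (fun u => Real.sqrt_nonneg _) hWm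
    (fun u => (hW u).1) (Real.sqrt_nonneg lam)
    ((Real.sqrt_lt' one_pos).2 (by rwa [one_pow])) (Real.sqrt_nonneg b)
    (fun u => (hW u).2) (Nat.succ_ne_zero N)
    (fun R => by
      -- The sublevel set `√V ≤ R` lies in the ball of this radius.
      obtain ⟨ν, h1, h2, h3⟩ := SagaLD.exists_minorizing_measure (d := d) hN hM.le hlip hF hη
        (√(1 + 1 / κ) * R)
      refine ⟨ν, h1, h2, fun u hu => h3 u ?_⟩
      refine (SagaLD.norm_le_euclNorm u).trans ((hnorm u).trans ?_)
      gcongr)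
  set Z := SagaLD.chain F η X₀ S ξ with hZdef
  have hZ : ∀ n, Measurable (Z n) := SagaLD.measurable_chain hF hX₀_meas hS_meas hξ_meas
  have hpair : ∀ i k, P.map (fun ω => (Z i ω, Z (i + k) ω)) = (P.map (Z i)) ⊗ₘ (K ^ k) :=
    SagaLD.map_chain_pair hF hN hX₀_meas hS_meas hξ_meas hS_law hS_indep hξ_law hξ_indep
      hξS_indep hX₀_indep
  have hlaw : ∀ n, P.map (Z n) = ⇑(K ^ n) ∘ₘ P.map (Z 0) :=
    SagaLD.map_eq_pow_comp (SagaLD.measurable_sagaMap hF η) hZ hpair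
  have hprob0 : IsProbabilityMeasure (P.map (Z 0)) :=
    Measure.isProbabilityMeasure_map (hZ 0).aemeasurable
  have hVinit : Integrable (SagaLD.lyapunov κ) (P.map (Z 0)) := by
    rw [integrable_map_measure hVm.aestronglyMeasurable (hZ 0).aemeasurable]
    exact SagaLD.integrable_lyapunov_initial hF hX₀_meas hinit hlip κ
  -- The iterated drift bounds the expectation of `V` uniformly in time, which is the second moment
  -- bound of the law of large numbers.
  have hVn : ∀ n, Integrable (SagaLD.lyapunov κ) (P.map (Z n)) ∧
      ∫ u, SagaLD.lyapunov κ u ∂P.map (Z n)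
        ≤ ∫ u, SagaLD.lyapunov κ u ∂P.map (Z 0) + b / (1 - lam) := fun n => by
    have hd := SagaLD.drift_pow hV0 hVm hVi hlam0 hlam1 hV n
    rw [hlaw n]
    refine SagaLD.integrable_comp_of_integral_le hV0 hVm (fun u => (hd u).1) (fun u => ?_) hVinit
    refine (hd u).2.trans (add_le_add ?_ ?_)
    · exact mul_le_of_le_one_left (hV0 u) (pow_le_one₀ hlam0 hlam1.le)
    · refine mul_le_of_le_one_right (div_nonneg hb (by linarith)) ?_
      have := pow_nonneg hlam0 n
      linarith
  have hsq : ∀ u : SagaLD.State d N, √(SagaLD.lyapunov κ u) ^ 2 = SagaLD.lyapunov κ u :=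
    fun u => Real.sq_sqrt (hV0 u)
  have hW2 : ∀ i, Integrable (fun ω => √(SagaLD.lyapunov κ (Z i ω)) ^ 2) P ∧
      ∫ ω, √(SagaLD.lyapunov κ (Z i ω)) ^ 2 ∂P
        ≤ ∫ u, SagaLD.lyapunov κ u ∂P.map (Z 0) + b / (1 - lam) := fun i => by
    simp only [hsq]
    have h := hVn i
    rw [integrable_map_measure hVm.aestronglyMeasurable (hZ i).aemeasurable,
      integral_map (hZ i).aemeasurable hVm.aestronglyMeasurable] at h
    exact h
  have hWinit : Integrable (fun u => √(SagaLD.lyapunov κ u)) (P.map (Z 0)) :=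
    ((memLp_two_iff_integrable_sq hWm.aestronglyMeasurable).2
      (by simpa only [hsq] using hVinit)).integrable one_le_two
  obtain ⟨π, hπ, hWπ, hinv⟩ := H.exists_invariant hWinit
  refine ⟨π, hπ, ?_, ?_⟩
  · have := H.tendsto_dTV (measurableSet_eq_fun measurable_fst measurable_snd).compl hWinit hWπ hinv
    refine this.congr fun n => ?_
    rw [← hlaw n]
  · rintro φ hφ ⟨C, hC, hφC⟩
    have hφW : ∀ u, |φ u| ≤ C * (1 + √(1 + 1 / κ)) * (1 + √(SagaLD.lyapunov κ u)) := fun u => by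
      refine (hφC u).trans ?_
      rw [mul_assoc]
      refine mul_le_mul_of_nonneg_left ?_ hC.le
      have := Real.sqrt_nonneg (1 + 1 / κ)
      have := Real.sqrt_nonneg (SagaLD.lyapunov κ u)
      have := hnorm u
      nlinarith
    obtain ⟨iπ, iφ, hlim⟩ := H.tendsto_average hWπ hinv hZ hpair hW2 hφ (by positivity) hφW
    refine ⟨iπ, iφ, hlim, ?_⟩
    have iavg : ∀ n, Integrable (fun ω => SagaLD.ergodicAverage φ Z n ω) P := fun n =>
      (integrable_finsetSum _ fun j _ => iφ j).div_const _
    refine SagaLD.tendstoInMeasure_of_tendsto_integral_abs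
      (fun n => (iavg n).sub (integrable_const _)) (fun n => ?_) hlim
    have hs : Measurable fun ω => ∑ j ∈ Finset.Icc 1 n, φ (Z j ω) :=
      Finset.measurable_sum _ fun j _ => hφ.comp (hZ j)
    exact hs.div_const _
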